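/- Let $p,q$ be odd primes with $q\mid p-1$, let $G=Z_p\rtimes Z_q$ be the non-abelian semidirect product, and let $\mathbb{F}$ be an algebraically closed field whose characteristic does not divide $|G|=pq$. Let $W$ be an arbitrary finite-dimensional $G$-module over $\mathbb{F}$. Let $L=\mathbb{F}[W]$ be its coordinate ring, i.e. the symmetric algebra of $W^*$ with its standard grading $L=\bigoplus_{d\ge 0}L_d$, put $L_+=\bigoplus_{d\ge 1}L_d$, and let $R=\mathbb{F}[W]^G$ be the ring of polynomial invariants. Denote by $\beta(L_+,R)$ the least $s\in\mathbb{N}$ such that $L_+$ is generated as an $R$-module by its elements of degree at most $s$ (and $\beta(L_+,R)=\infty$ if $L_+$ is not finitely generated over $R$). Then $\beta(L_+,R)$ is finite and $$\beta(L_+,R)\le\begin{cases}\tfrac32\bigl(p+(q-2)q\bigr)-2 & \text{if } p>q(q-2),\\ 2p+(q-2)q-2 & \text{if } p<q(q-2),\\ 2p+(q-2)(c-1)-2 & \text{if } c \text{ is a natural number with } c(c-1)<2p<c(c+1) \text{ and } c\le q.\end{cases}$$ The cases are not mutually exclusive; each bound holds whenever its condition does. -/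

import Mathlib

namespace InvariantDegree

open Classical in
/-- `β(M, R)` for an `R`-module `M` with homogeneous components `𝓜 d`, `d = 0, 1, 2, …`:
if `M` is finitely generated over `R`, the least `s` such that
`M_{≤ s} = M_0 ⊕ ⋯ ⊕ M_s` generates `M` as an `R`-module; otherwise `∞`. -/
noncomputable def beta {F : Type*} (R : Type*) {M : Type*} [Field F] [CommRing R]
    [AddCommGroup M] [Module F M] [Module R M] (𝓜 : ℕ → Submodule F M) : ℕ∞ :=
  if Module.Finite R M then
    sInf {t : ℕ∞ | ∃ s : ℕ, t = (s : ℕ∞) ∧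
      Submodule.span R ((⨆ d ∈ Set.Iic s, 𝓜 d : Submodule F M) : Set M) = ⊤}
  else ⊤

section

variable (F : Type*) (W : Type*) [Field F] [AddCommGroup W] [Module F W]

/-- The coordinate ring `F[W]`: the symmetric algebra of the dual space of `W`. -/
abbrev CoordRing : Type _ := SymmetricAlgebra F (Module.Dual F W)

/-- The homogeneous component `F[W]_d`: the `d`-th symmetric power of `W^*` inside `F[W]`,
that is, the span of the `d`-fold products of linear forms. -/
noncomputable def component (d : ℕ) : Submodule F (CoordRing F W) :=
  LinearMap.range (SymmetricAlgebra.ι F (Module.Dual F W)) ^ d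

/-- `F[W]_+`, the maximal homogeneous ideal of `F[W]`. As a vector space it is the sum of the
components of positive degree, see `plusIdeal_restrictScalars`. -/
noncomputable def plusIdeal : Ideal (CoordRing F W) :=
  Ideal.span (⋃ d ∈ Set.Ici 1, (component F W d : Set (CoordRing F W)))

/-- The homogeneous components of `F[W]_+`. -/
noncomputable def plusComponent (d : ℕ) : Submodule F (plusIdeal F W) :=
  (component F W d).comap ((plusIdeal F W).subtype.restrictScalars F)

theorem iSup_component : (⨆ d, component F W d) = ⊤ := by
  refine eq_top_iff.2 fun x _ => ?_
  induction x using SymmetricAlgebra.induction with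
  | algebraMap r =>
    refine Submodule.mem_iSup_of_mem 0 ?_
    rw [component, pow_zero]
    exact Submodule.algebraMap_mem r
  | ι x =>
    refine Submodule.mem_iSup_of_mem 1 ?_
    rw [component, pow_one]
    exact ⟨x, rfl⟩
  | add a b ha hb => exact add_mem (ha trivial) (hb trivial)
  | mul a b ha hb =>
    have hab := Submodule.mul_mem_mul (ha trivial) (hb trivial)
    rw [Submodule.iSup_mul] at hab
    refine (iSup_le fun i => ?_ : _ ≤ ⨆ d, component F W d) hab
    rw [Submodule.mul_iSup]
    refine iSup_le fun j => ?_
    rw [component, component, ← pow_add]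
    exact le_iSup (component F W) (i + j)

theorem plusIdeal_restrictScalars :
    (plusIdeal F W).restrictScalars F = ⨆ d ∈ Set.Ici 1, component F W d := by
  apply le_antisymm
  · intro x hx
    have hx' : x ∈ Ideal.span (⋃ d ∈ Set.Ici 1, (component F W d : Set (CoordRing F W))) := hx
    refine Submodule.span_induction (p := fun y _ => y ∈ ⨆ d ∈ Set.Ici 1, component F W d)
      ?_ (zero_mem _) (fun _ _ _ _ h k => add_mem h k) ?_ hx'
    · intro y hy
      simp only [Set.mem_iUnion] at hy
      obtain ⟨d, hd, hy⟩ := hy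
      exact Submodule.mem_iSup_of_mem d (Submodule.mem_iSup_of_mem hd hy)
    · intro a y _ hy
      have ha : a ∈ ⨆ d, component F W d := by rw [iSup_component]; trivial
      have h := Submodule.mul_mem_mul ha hy
      rw [Submodule.iSup_mul] at h
      refine (iSup_le fun i => ?_ : _ ≤ ⨆ d ∈ Set.Ici 1, component F W d) h
      rw [Submodule.mul_iSup]
      refine iSup_le fun j => ?_
      rw [Submodule.mul_iSup]
      refine iSup_le fun hj => ?_
      rw [component, component, ← pow_add]
      exact le_biSup (component F W) (show i + j ∈ Set.Ici 1 from le_trans hj (Nat.le_add_left j i))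
  · refine iSup₂_le fun d hd x hx => ?_
    exact Ideal.subset_span (Set.mem_biUnion hd hx)

end

section

variable {F G W : Type*} [Field F] [Group G] [AddCommGroup W] [Module F W]

/-- The substitution `f ↦ f^g` on `F[W]`: the `F`-algebra endomorphism which sends a linear
form `x` to the linear form `w ↦ x (g w)`. -/
noncomputable def act (ρ : Representation F G W) (g : G) : CoordRing F W →ₐ[F] CoordRing F W :=
  SymmetricAlgebra.lift
    (SymmetricAlgebra.ι F (Module.Dual F W) ∘ₗ Module.Dual.transpose (R := F) (ρ g))

/-- The ring of polynomial invariants `F[W]^G`. -/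
noncomputable def invariants (ρ : Representation F G W) : Subalgebra F (CoordRing F W) where
  carrier := {f | ∀ g : G, act ρ g f = f}
  mul_mem' ha hb g := by rw [map_mul, ha g, hb g]
  add_mem' ha hb g := by rw [map_add, ha g, hb g]
  algebraMap_mem' r g := AlgHom.commutes _ r

/-- `β(L_+, R)` for `L = F[W]` and `R = F[W]^G`. -/
noncomputable def betaPlus (ρ : Representation F G W) : ℕ∞ :=
  beta (F := F) (invariants ρ) (plusComponent F W)

end

end InvariantDegree

/-! Eigenvectors in `W^*` of the generator of `Z_p` carry weights in `ZMod p` and span `W^*`; the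
generator of `Z_q` multiplies weights by a residue `r` of order `q`. So `L_+` is spanned by the
monomials in weight vectors. It suffices that, above the stated degree, such a monomial lies in
every `R`-submodule that contains all monomials of smaller positive degree.

If `u` has weight sum zero, its orbit sum over `Z_q` is in `R`. Multiplying by a nonempty monomial
`v` shows that `u v` is in the submodule as soon as the products of `v` with the other translates of
`u` are (`orbitClosed_of_submodule`). Benson's identity, with `q` invertible, shows that `u_1 ⋯ u_q
v` is in it whenever all `u_i` are zero-sum (`productClosed_of_submodule`). What remains concerns
multisets of residues only (`IsReducible`).

There one splits off `q - 1` zero-sum pieces of size at most `k`, then one of size at most `p`. As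
long as no short piece is guaranteed, some zero-sum piece is replaced by its translates so that a
lexicographic profile grows. This must stop, and it stops at a multiset that contains `0` or a
gapless submultiset of `N` elements (`exists_gapless_or_exists_profile_lt`). Degrees from `(q - 2) k
+ N + p - 1` on are thus reducible.

The three bounds are three ways to find a short zero-sum in a gapless multiset: Cauchy–Davenport on
its levels, with `N = p` and `k = q` or `k = c - 1`; or Dias da Silva–Hamidoune on its support, with
`k = q` and `N = (p + q (q - 2)) / 2`. -/

/-! ### Zero-sum subsets of prescribed size, by the polynomial method. -/

section DistinctSums

open MvPolynomial Finset

variable {K : Type*} [Field K] {n : ℕ}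

/-- The coefficient is the multinomial `m! / ∏ (c i - e i)!`; multiplying by `∏ (c i)!` avoids
division, so the identity holds in every characteristic. Both sides vanish if some `e i` exceeds `c
i`. -/
theorem prod_factorial_mul_coeff_sum_X_pow_mul_monomial (c e : Fin n →₀ ℕ) (m : ℕ)
    (h : ∑ i, c i = m + ∑ i, e i) :
    (∏ i, ((c i).factorial : K)) * coeff c ((∑ i, X i : MvPolynomial (Fin n) K) ^ m * monomial e 1)
      = m.factorial * ∏ i, ((c i).descFactorial (e i) : K) := by
  rw [coeff_mul_monomial', mul_one]
  split_ifs with hle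
  · rw [coeff_sum_X_pow_of_fintype]
    have hce : ∀ i, e i ≤ c i := fun i => hle i
    have hs : ∑ i, (c - e) i = m := by
      have : ∑ i, (c - e) i + ∑ i, e i = ∑ i, c i := by
        rw [← Finset.sum_add_distrib]
        refine Finset.sum_congr rfl fun i _ => ?_
        rw [Finsupp.tsub_apply]
        exact Nat.sub_add_cancel (hce i)
      omega
    rw [if_pos (by rw [Finsupp.sum_fintype _ _ (fun _ => rfl)]; exact hs)]
    rw [← Finsupp.multinomial_of_support_subset (Finset.subset_univ _)]
    have h1 := Nat.multinomial_spec Finset.univ (c - e : Fin n →₀ ℕ)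
    rw [hs] at h1
    rw [← h1]
    have h2 : ∀ i, (c i).factorial = ((c - e) i).factorial * (c i).descFactorial (e i) := fun i => by
      rw [Finsupp.tsub_apply, Nat.factorial_mul_descFactorial (hce i)]
    simp_rw [h2]
    push_cast
    rw [Finset.prod_mul_distrib]
    ring
  · rw [mul_zero]
    have : ∃ i, c i < e i := by
      by_contra! hcon
      exact hle hcon
    obtain ⟨i, hi⟩ := this
    rw [Finset.prod_eq_zero (Finset.mem_univ i), mul_zero]
    rw [Nat.descFactorial_of_lt hi, Nat.cast_zero]

theorem det_vandermonde_X_eq_sum_monomial :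
    (Matrix.vandermonde (X : Fin n → MvPolynomial (Fin n) K)).det =
      ∑ s : Equiv.Perm (Fin n), (Equiv.Perm.sign s) •
        monomial (Finsupp.equivFunOnFinite.symm fun i => ((s⁻¹ i : Fin n) : ℕ)) (1 : K) := by
  rw [Matrix.det_apply]
  refine Finset.sum_congr rfl fun s _ => ?_
  congr 1
  rw [monomial_eq, C_1, one_mul, Finsupp.prod_fintype _ _ (fun _ => pow_zero _)]
  conv_rhs => rw [← Equiv.prod_comp s]
  simp [Matrix.vandermonde_apply]

/-- The coefficients of the Dyson-type product of a power of the sum of the variables with their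
Vandermonde determinant. -/
theorem prod_factorial_mul_coeff_sum_X_pow_mul_vandermonde (c : Fin n →₀ ℕ) (m : ℕ)
    (h : ∑ i, c i = m + ∑ i : Fin n, (i : ℕ)) :
    (∏ i, ((c i).factorial : K)) * coeff c ((∑ i, X i : MvPolynomial (Fin n) K) ^ m *
      (Matrix.vandermonde (X : Fin n → MvPolynomial (Fin n) K)).det)
      = m.factorial * (Matrix.vandermonde fun i => (c i : K)).det := by
  -- Falling factorials are monic of degree `j`, so they may replace the powers in the Vandermonde
  -- determinant.
  rw [Matrix.det_eval_matrixOfPolynomials_eq_det_vandermonde _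
    (fun j : Fin n => descPochhammer K j) (fun i => descPochhammer_natDegree K i)
    (fun i => monic_descPochhammer K i), det_vandermonde_X_eq_sum_monomial, Finset.mul_sum,
    coeff_sum, Finset.mul_sum, Matrix.det_apply, Finset.mul_sum]
  refine Finset.sum_congr rfl fun s _ => ?_
  have hs : ∑ i, c i = m + ∑ i, (Finsupp.equivFunOnFinite.symm
      fun i => ((s⁻¹ i : Fin n) : ℕ)) i := by
    rw [h]
    congr 1
    exact (Equiv.sum_comp s⁻¹ (fun i : Fin n => (i : ℕ))).symm
  have key := prod_factorial_mul_coeff_sum_X_pow_mul_monomial (K := K) c _ m hs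
  have hprod : ∏ i, ((c i).descFactorial ((Finsupp.equivFunOnFinite.symm
      fun i => ((s⁻¹ i : Fin n) : ℕ)) i) : K) =
      ∏ i, Matrix.of (fun i j : Fin n => (descPochhammer K j).eval (c i : K)) (s i) i := by
    rw [← Equiv.prod_comp s]
    simp [descPochhammer_eval_eq_descFactorial]
  rw [hprod] at key
  rw [mul_smul_comm, coeff_smul, mul_smul_comm, mul_smul_comm, key]

theorem totalDegree_vandermonde_X_le :
    (Matrix.vandermonde (X : Fin n → MvPolynomial (Fin n) K)).det.totalDegree ≤
      ∑ i : Fin n, (i : ℕ) := by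
  rw [det_vandermonde_X_eq_sum_monomial]
  refine totalDegree_finsetSum_le fun s _ => ?_
  rw [Units.smul_def]
  refine (totalDegree_smul_le _ _).trans ((totalDegree_monomial_le _ _).trans (le_of_eq ?_))
  rw [Finsupp.sum_fintype _ _ (fun _ => rfl)]
  exact Equiv.sum_comp s⁻¹ (fun i : Fin n => (i : ℕ))

/-- The extremal case of the **Dias da Silva–Hamidoune theorem**: a set of `a` residues modulo a
prime `p` with `n * a = p - 1 + n ^ 2` has an `n`-element subset whose sum is zero. -/
theorem exists_card_eq_sum_eq_zero {p : ℕ} [Fact p.Prime] (A : Finset (ZMod p))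
    (hn : 0 < n) (hA : n * #A = p - 1 + n ^ 2) : ∃ B ⊆ A, #B = n ∧ ∑ x ∈ B, x = 0 := by
  have hp : p.Prime := Fact.out
  have hp2 := hp.two_le
  set a := #A with ha
  have hap : a ≤ p := by
    have := Finset.card_le_univ A
    rwa [ZMod.card] at this
  have hna : n < a := by
    by_contra! hcon
    have := Nat.mul_le_mul_left n hcon
    nlinarith [hA, Nat.sub_pos_of_lt hp.one_lt]
  -- Distinct exponents below `a`; the relation `n * a = p - 1 + n ^ 2` makes their sum equal to the
  -- degree of `S ^ (p - 1) * V`.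
  set c : Fin n →₀ ℕ := Finsupp.equivFunOnFinite.symm fun i => a - 1 - (i : ℕ) with hc
  have hci : ∀ i, c i = a - 1 - (i : ℕ) := fun i => rfl
  have hsum : ∑ i, c i = (p - 1) + ∑ i : Fin n, (i : ℕ) := by
    have h1 : ∑ i, c i + ∑ i : Fin n, (i : ℕ) = n * (a - 1) := by
      rw [← Finset.sum_add_distrib]
      rw [Finset.sum_congr rfl (g := fun _ => a - 1) (fun i _ => by rw [hci]; omega)]
      simp
    have h2 : (∑ i : Fin n, (i : ℕ)) * 2 = n * (n - 1) := by
      rw [Fin.sum_univ_eq_sum_range (fun i => i), Finset.sum_range_id_mul_two]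
    obtain ⟨n', rfl⟩ : ∃ n', n = n' + 1 := ⟨n - 1, by omega⟩
    obtain ⟨a', ha'⟩ : ∃ a', a = a' + 1 := ⟨a - 1, by omega⟩
    rw [ha'] at hA h1
    simp only [Nat.add_sub_cancel] at h1 h2
    nlinarith
  set V := (Matrix.vandermonde (X : Fin n → MvPolynomial (Fin n) (ZMod p))).det with hV
  set S : MvPolynomial (Fin n) (ZMod p) := ∑ i, X i with hS
  have hcoeff : coeff c (S ^ (p - 1) * V) ≠ 0 := by
    intro h0
    have := prod_factorial_mul_coeff_sum_X_pow_mul_vandermonde (K := ZMod p) c (p - 1) hsum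
    rw [h0, mul_zero] at this
    rcases mul_eq_zero.1 this.symm with h | h
    · rw [ZMod.natCast_eq_zero_iff, hp.dvd_factorial] at h
      omega
    · refine Matrix.det_vandermonde_ne_zero_iff.2 (fun i j hij => ?_) h
      rw [ZMod.natCast_eq_natCast_iff', hci, hci, Nat.mod_eq_of_lt (by omega),
        Nat.mod_eq_of_lt (by omega)] at hij
      apply Fin.ext
      omega
  have hdegV : V.totalDegree ≤ ∑ i : Fin n, (i : ℕ) := totalDegree_vandermonde_X_le
  have hdegS : (S ^ (p - 1)).totalDegree ≤ p - 1 := by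
    refine (totalDegree_pow _ _).trans ?_
    have : S.totalDegree ≤ 1 := totalDegree_finsetSum_le fun i _ => (totalDegree_X i).le
    simpa using Nat.mul_le_mul_left (p - 1) this
  have hcdeg : c.degree = (p - 1) + ∑ i : Fin n, (i : ℕ) := by
    rw [← hsum, Finsupp.degree_eq_sum]
  -- By Fermat, `P` is nonzero only at points with coordinate sum zero and distinct coordinates.
  set P := (1 - S ^ (p - 1)) * V with hP
  have hcV : coeff c V = 0 := by
    apply coeff_eq_zero_of_totalDegree_lt
    rw [← Finsupp.degree_apply, hcdeg]
    omega
  have hcP : coeff c P ≠ 0 := by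
    rw [hP, sub_mul, one_mul, coeff_sub, hcV, zero_sub, neg_ne_zero]
    exact hcoeff
  have hPdeg : P.totalDegree = c.degree := by
    apply le_antisymm
    · rw [hcdeg]
      refine (totalDegree_mul _ _).trans (add_le_add ((totalDegree_sub _ _).trans ?_) hdegV)
      simpa using hdegS
    · exact le_totalDegree (mem_support_iff.2 hcP)
  obtain ⟨s, hsA, hs⟩ := combinatorial_nullstellensatz_exists_eval_nonzero P c hcP hPdeg
    (fun _ => A) (fun i => by rw [hci, ← ha]; omega)
  rw [hP, map_mul] at hs
  have hs1 : ∑ i, s i = 0 := by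
    by_contra h
    apply left_ne_zero_of_mul hs
    rw [map_sub, map_one, map_pow, hS, map_sum]
    simp only [eval_X]
    rw [ZMod.pow_card_sub_one_eq_one h, sub_self]
  have hs2 : Function.Injective s := by
    rw [← Matrix.det_vandermonde_ne_zero_iff]
    have h3 := right_ne_zero_of_mul hs
    rw [hV, RingHom.map_det] at h3
    convert h3 using 2
    ext i j
    simp [Matrix.vandermonde_apply]
  refine ⟨Finset.univ.image s, ?_, ?_, ?_⟩
  · intro x hx
    obtain ⟨i, -, rfl⟩ := Finset.mem_image.1 hx
    exact hsA i
  · rw [Finset.card_image_of_injective _ hs2, Finset.card_fin]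
  · rw [Finset.sum_image (fun _ _ _ _ h => hs2 h)]
    exact hs1

end DistinctSums

/-! ### Short zero-sums from Cauchy–Davenport. -/

section ZeroSum

open Finset
open scoped Pointwise

variable {p : ℕ} [Fact p.Prime]

/-- `m` has a nonempty zero-sum submultiset with at most `k` elements. -/
def HasShortZeroSum (k : ℕ) (m : Multiset (ZMod p)) : Prop :=
  ∃ u ≤ m, u ≠ 0 ∧ u.sum = 0 ∧ u.card ≤ k

theorem HasShortZeroSum.mono {k l : ℕ} {m n : Multiset (ZMod p)} (h : HasShortZeroSum k m)
    (hkl : k ≤ l) (hmn : m ≤ n) : HasShortZeroSum l n := by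
  obtain ⟨u, hu, h0, hs, hc⟩ := h
  exact ⟨u, hu.trans hmn, h0, hs, hc.trans hkl⟩

theorem hasShortZeroSum_of_zero_mem {k : ℕ} (hk : 1 ≤ k) {m : Multiset (ZMod p)} (h : 0 ∈ m) :
    HasShortZeroSum k m :=
  ⟨{0}, Multiset.singleton_le.2 h, by simp, by simp, by simpa using hk⟩

/-- An iterated form of the Cauchy–Davenport inequality. -/
theorem exists_finset_sums (P : Multiset (Finset (ZMod p))) (hP : ∀ B ∈ P, (0 : ZMod p) ∉ B) :
    ∃ C : Finset (ZMod p), min p (1 + (P.map card).sum) ≤ #C ∧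
      ∀ y ∈ C, ∃ u ≤ (P.map Finset.val).sum, u.card ≤ P.card ∧ u.sum = y := by
  classical
  induction P using Multiset.induction with
  | empty => exact ⟨{0}, by simp, fun y hy => ⟨0, by simp, by simp, by simpa using (Finset.mem_singleton.1 hy).symm⟩⟩
  | cons B P ih =>
    obtain ⟨C, hC, hCs⟩ := ih fun B hB => hP B (Multiset.mem_cons_of_mem hB)
    -- Adjoining `0` allows the block `B` to be skipped, and makes it contribute its full
    -- cardinality to the bound.
    refine ⟨insert 0 B + C, ?_, ?_⟩
    · have hC0 : C.Nonempty := by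
        rw [← card_pos]
        exact lt_of_lt_of_le (lt_min (Fact.out : p.Prime).pos (by omega)) hC
      have h := ZMod.cauchy_davenport (Fact.out : p.Prime) (insert_nonempty 0 B) hC0
      rw [card_insert_of_notMem (hP B (Multiset.mem_cons_self B P))] at h
      rw [Multiset.map_cons, Multiset.sum_cons]
      omega
    · intro y hy
      obtain ⟨b, hb, c, hc, rfl⟩ := mem_add.1 hy
      obtain ⟨u, hu, huc, hus⟩ := hCs c hc
      rw [Multiset.map_cons, Multiset.sum_cons, Multiset.card_cons]
      rcases mem_insert.1 hb with rfl | hb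
      · exact ⟨u, hu.trans (Multiset.le_add_left _ _), by omega, by rw [hus, zero_add]⟩
      · exact ⟨{b} + u, add_le_add (Multiset.singleton_le.2 hb) hu, by simp; omega, by simp [hus]⟩

/-- The sums of at most one element per block of `P` and the negatives of `B` together exceed `p` in
number, hence meet. Forcing an element of `B` keeps the zero-sum nonempty. -/
theorem hasShortZeroSum_of_finsets (B : Finset (ZMod p)) (P : Multiset (Finset (ZMod p)))
    (hB : B.Nonempty) (hP : ∀ B ∈ P, (0 : ZMod p) ∉ B) (h : p ≤ #B + (P.map card).sum) :
    HasShortZeroSum (P.card + 1) (B.val + (P.map Finset.val).sum) := by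
  classical
  obtain ⟨C, hC, hCs⟩ := exists_finset_sums P hP
  have hB' := card_pos.2 hB
  have hne : (C ∩ B.image (- ·)).Nonempty := by
    apply inter_nonempty_of_card_lt_card_add_card (subset_univ C) (subset_univ _)
    rw [card_univ, ZMod.card, card_image_of_injective _ neg_injective]
    omega
  obtain ⟨y, hy⟩ := hne
  obtain ⟨hyC, hyB⟩ := mem_inter.1 hy
  obtain ⟨b, hb, rfl⟩ := mem_image.1 hyB
  obtain ⟨u, hu, huc, hus⟩ := hCs _ hyC
  exact ⟨{b} + u, add_le_add (Multiset.singleton_le.2 hb) hu, by simp, by simp [hus],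
    by simp; omega⟩

/-- Cauchy–Davenport with singleton blocks: each of `p - 1` nonzero residues enlarges the set of
subset sums until it is everything. -/
theorem exists_le_sum_eq (m : Multiset (ZMod p)) (h0 : (0 : ZMod p) ∉ m) (hm : p ≤ m.card + 1)
    (y : ZMod p) : ∃ u ≤ m, u.sum = y := by
  obtain ⟨C, hC, hCs⟩ := exists_finset_sums (m.map fun x => ({x} : Finset (ZMod p))) (by
    intro B hB
    obtain ⟨x, hx, rfl⟩ := Multiset.mem_map.1 hB
    intro h
    rw [Finset.mem_singleton.1 h] at h0
    exact h0 hx)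
  have hval : ((m.map fun x => ({x} : Finset (ZMod p))).map Finset.val).sum = m := by
    simp [Multiset.map_map]
  have hcard : ((m.map fun x => ({x} : Finset (ZMod p))).map card).sum = m.card := by
    simp [Multiset.map_map]
  rw [hcard] at hC
  rw [hval] at hCs
  have hCu : C = univ := by
    apply eq_univ_of_card
    have := card_le_univ C
    rw [ZMod.card] at *
    omega
  obtain ⟨u, hu, -, hus⟩ := hCs y (hCu ▸ mem_univ y)
  exact ⟨u, hu, hus⟩

theorem Multiset.exists_le_card_eq_of_le_card {α : Type*} {m : Multiset α} {k : ℕ}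
    (h : k ≤ m.card) : ∃ n ≤ m, n.card = k := by
  induction m using Quotient.inductionOn with
  | h l => exact ⟨(l.take k : List α), (List.take_sublist k l).subperm, by simpa using h⟩

/-- The Davenport constant of `Z_p`: of `p` nonzero residues fix one, and write its negative as a
subset sum of the others. -/
theorem hasShortZeroSum_of_le_card {m : Multiset (ZMod p)} (hm : p ≤ m.card) :
    HasShortZeroSum p m := by
  have hp := (Fact.out : p.Prime).pos
  by_cases h0 : (0 : ZMod p) ∈ m
  · exact hasShortZeroSum_of_zero_mem hp h0
  obtain ⟨n, hnm, hn⟩ := Multiset.exists_le_card_eq_of_le_card hm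
  obtain ⟨x, l, rfl⟩ : ∃ x l, n = x ::ₘ l := by
    obtain ⟨x, hx⟩ := Multiset.card_pos_iff_exists_mem.1 (hn.symm ▸ hp)
    exact ⟨x, _, (Multiset.cons_erase hx).symm⟩
  rw [Multiset.card_cons] at hn
  obtain ⟨u, hu, hus⟩ := exists_le_sum_eq l
    (fun h => h0 (Multiset.mem_of_le hnm (Multiset.mem_cons_of_mem h))) (by omega) (-x)
  refine ⟨x ::ₘ u, (Multiset.cons_le_cons x hu).trans hnm, by simp, by simp [hus], ?_⟩
  have := Multiset.card_le_card hu
  rw [Multiset.card_cons]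
  omega

/-- The elements of `m` whose multiplicity is greater than `t`. -/
def level (m : Multiset (ZMod p)) (t : ℕ) : Finset (ZMod p) := {w | t < m.count w}

theorem mem_level {m : Multiset (ZMod p)} {t : ℕ} {w : ZMod p} :
    w ∈ level m t ↔ t < m.count w := by
  simp [level]

theorem level_subset_level (m : Multiset (ZMod p)) {s t : ℕ} (h : s ≤ t) :
    level m t ⊆ level m s := fun w hw => by
  rw [mem_level] at *
  omega

theorem sum_eq_sum_card_lt {ι : Type*} (s : Finset ι) (g : ι → ℕ) (T : ℕ)
    (h : ∀ i ∈ s, g i ≤ T) : ∑ i ∈ s, g i = ∑ t ∈ range T, #{i ∈ s | t < g i} := by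
  have h1 : ∀ i ∈ s, g i = #{t ∈ range T | t < g i} := fun i hi => by
    have : {t ∈ range T | t < g i} = range (g i) := by
      ext t
      have := h i hi
      simp only [mem_filter, mem_range]
      omega
    rw [this, card_range]
  rw [sum_congr rfl h1]
  simp_rw [card_filter]
  rw [sum_comm]

theorem card_eq_sum_card_level (m : Multiset (ZMod p)) (T : ℕ) (h : ∀ w, m.count w ≤ T) :
    m.card = ∑ t ∈ range T, #(level m t) := by
  rw [← Multiset.sum_count_eq_card (s := univ) (fun a _ => mem_univ a),
    sum_eq_sum_card_lt _ _ T fun w _ => h w]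
  rfl

theorem count_sum_level (m : Multiset (ZMod p)) (k : ℕ) (w : ZMod p) :
    (∑ t ∈ range k, (level m t).val).count w = min k (m.count w) := by
  have h2 : ∀ t, (level m t).val.count w = if t < m.count w then 1 else 0 := fun t => by
    rw [Multiset.count_eq_of_nodup (level m t).nodup]
    simp [mem_level]
  simp_rw [Multiset.count_sum', h2, ← card_filter]
  have : {t ∈ range k | t < m.count w} = range (min k (m.count w)) := by
    ext t
    simp
  rw [this, card_range]

theorem sum_level_le (m : Multiset (ZMod p)) (k : ℕ) : ∑ t ∈ range k, (level m t).val ≤ m := by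
  rw [Multiset.le_iff_count]
  intro w
  rw [count_sum_level]
  exact min_le_right _ _

/-- The first `k` levels serve as blocks: together they form `m` with multiplicities truncated at
`k`, so one element from each is available at once. -/
theorem hasShortZeroSum_of_levels {m : Multiset (ZMod p)} (h0 : (0 : ZMod p) ∉ m) (k : ℕ)
    (h : p ≤ ∑ t ∈ range k, #(level m t)) : HasShortZeroSum k m := by
  have hp := (Fact.out : p.Prime).pos
  obtain ⟨k, rfl⟩ : ∃ l, k = l + 1 := by
    refine ⟨k - 1, ?_⟩
    rcases k with - | k
    · simp at h; omega
    · omega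
  have hL0 : ∀ t, (0 : ZMod p) ∉ level m t := fun t ht => h0 (by
    rw [mem_level] at ht
    exact Multiset.count_pos.1 (by omega))
  have hk : (level m 0).Nonempty := by
    rw [nonempty_iff_ne_empty]
    intro he
    rw [sum_eq_zero fun t _ => ?_] at h
    · omega
    · rw [card_eq_zero, ← subset_empty, ← he]
      exact level_subset_level m (Nat.zero_le t)
  rw [sum_range_succ', add_comm] at h
  have h1 := hasShortZeroSum_of_finsets (level m 0)
    ((Multiset.range k).map fun t => level m (t + 1)) hk
    (by
      intro B hB
      obtain ⟨t, -, rfl⟩ := Multiset.mem_map.1 hB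
      exact hL0 _)
    (by
      rw [Multiset.map_map]
      exact h)
  refine h1.mono (by simp) (le_trans (le_of_eq ?_) (sum_level_le m (k + 1)))
  rw [Multiset.map_map, sum_range_succ', add_comm]
  rfl

end ZeroSum

/-! ### Short zero-sums in gapless multisets. -/

section Gapless

open Finset

variable {p : ℕ}

/-- The multiplicities in `m` of the elements of an orbit of multiplication by `r` leave out no
value between the largest one and the smallest one or `1`. -/
def Gapless (r : ZMod p) (m : Multiset (ZMod p)) : Prop :=
  0 ∉ m ∧ ∀ w t, 1 ≤ t → t < m.count w →
    (∃ i : ℕ, m.count (r ^ i * w) = t) ∨ ∀ i : ℕ, t ≤ m.count (r ^ i * w)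

variable [Fact p.Prime] {q : ℕ} {r : ZMod p}

theorem pow_mul_injOn (hq : q.Prime) (hr : r ^ q = 1) (hr1 : r ≠ 1) {w : ZMod p} (hw : w ≠ 0) :
    Set.InjOn (fun i : ℕ => r ^ i * w) (Set.Iio q) := by
  have := Fact.mk hq
  have hord : orderOf r = q := orderOf_eq_prime hr hr1
  have hr0 : r ≠ 0 := by
    rintro rfl
    rw [zero_pow hq.ne_zero] at hr
    exact zero_ne_one hr
  have key : ∀ i j : ℕ, i ≤ j → j < q → r ^ i = r ^ j → i = j := by
    intro i j hij hj h
    obtain ⟨k, rfl⟩ := Nat.exists_eq_add_of_le hij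
    rw [pow_add] at h
    have h1 : r ^ k = 1 := (mul_right_eq_self₀.1 h.symm).resolve_right (pow_ne_zero _ hr0)
    have h2 := orderOf_dvd_of_pow_eq_one h1
    rw [hord] at h2
    have := Nat.eq_zero_of_dvd_of_lt h2 (by omega)
    omega
  intro i hi j hj h
  have h' : r ^ i = r ^ j := mul_right_cancel₀ hw h
  rcases le_total i j with hij | hij
  · exact key i j hij hj h'
  · exact (key j i hij hi h'.symm).symm

theorem pow_mul_mod (hr : r ^ q = 1) (i : ℕ) (w : ZMod p) : r ^ (i % q) * w = r ^ i * w := by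
  rw [← pow_eq_pow_mod i hr]

/-- A full orbit has sum `(1 + r + ⋯ + r ^ (q - 1)) w = 0`. -/
theorem hasShortZeroSum_of_forall_pow_mul_mem (hq : q.Prime) (hr : r ^ q = 1) (hr1 : r ≠ 1)
    {m : Multiset (ZMod p)} (h0 : 0 ∉ m) {w : ZMod p} (h : ∀ i : ℕ, r ^ i * w ∈ m) :
    HasShortZeroSum q m := by
  have hw : w ≠ 0 := by
    rintro rfl
    exact h0 (by simpa using h 0)
  have hinj := pow_mul_injOn hq hr hr1 hw
  have hinj' : Set.InjOn (fun i : ℕ => r ^ i * w) (range q : Set ℕ) := by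
    rwa [coe_range]
  refine ⟨((range q).image fun i => r ^ i * w).val, ?_, ?_, ?_, ?_⟩
  · rw [Multiset.le_iff_subset (Finset.nodup _)]
    intro x hx
    obtain ⟨i, -, rfl⟩ := mem_image.1 (Finset.mem_def.2 hx)
    exact h i
  · rw [Ne, val_eq_zero, image_eq_empty, range_eq_empty_iff]
    exact hq.ne_zero
  · rw [sum_val, sum_image hinj']
    simp only [id]
    rw [← sum_mul]
    have := mul_geom_sum r q
    rw [hr, sub_self] at this
    rw [(mul_eq_zero.1 this).resolve_left (sub_ne_zero.2 hr1), zero_mul]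
  · exact (card_image_le.trans (card_range q).le)

/-- Either the multiplicity `t + 1` occurs in the orbit of an element of the higher level, which
then drops out there, or the whole orbit lies in level `t`. -/
theorem Gapless.card_level_succ_lt (hq : q.Prime) (hr : r ^ q = 1) (hr1 : r ≠ 1)
    {m : Multiset (ZMod p)} (hm : Gapless r m) {t : ℕ} (h : (level m (t + 1)).Nonempty) :
    #(level m (t + 1)) < #(level m t) ∨ q ≤ #(level m t) := by
  obtain ⟨w, hw⟩ := h
  rw [mem_level] at hw
  rcases hm.2 w (t + 1) (by omega) hw with ⟨i, hi⟩ | h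
  · left
    apply card_lt_card
    rw [Finset.ssubset_iff_of_subset (level_subset_level m (Nat.le_succ t))]
    exact ⟨r ^ i * w, mem_level.2 (by omega), fun h => by rw [mem_level] at h; omega⟩
  · right
    have hw0 : w ≠ 0 := by
      rintro rfl
      exact hm.1 (Multiset.count_pos.1 (by omega))
    have hinj := pow_mul_injOn hq hr hr1 hw0
    have hinj' : Set.InjOn (fun i : ℕ => r ^ i * w) (range q : Set ℕ) := by
      rwa [coe_range]
    rw [← card_range q, ← card_image_of_injOn hinj']
    refine card_le_card fun x hx => ?_
    obtain ⟨i, -, rfl⟩ := mem_image.1 hx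
    exact mem_level.2 (h i)

theorem Gapless.hasShortZeroSum_pred (hq : q.Prime) (hr : r ^ q = 1) (hr1 : r ≠ 1)
    {m : Multiset (ZMod p)} (hm : Gapless r m) {c : ℕ} (hc : 2 ≤ c) (hcq : c ≤ q)
    (hpc : 2 * p < c * (c + 1)) (hp : p ≤ m.card) : HasShortZeroSum (c - 1) m := by
  have hlt := fun t => hm.card_level_succ_lt hq hr hr1 (t := t)
  obtain ⟨k, rfl⟩ : ∃ k, c = k + 2 := ⟨c - 2, by omega⟩
  apply hasShortZeroSum_of_levels hm.1
  rw [show k + 2 - 1 = k + 1 by omega]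
  -- If level `c - 2` has two elements, the levels below it have at least `3, …, c`, a total of `c
  -- (c + 1) / 2 - 1 ≥ p`. Otherwise no multiplicity exceeds `c - 1`, and the levels exhaust `m`.
  by_cases h2 : 2 ≤ #(level m k)
  · have key : ∀ j ≤ k, j + 2 ≤ #(level m (k - j)) := by
      intro j
      induction j with
      | zero => intro _; simpa using h2
      | succ j ih =>
        intro hj
        have h3 := ih (by omega)
        have h4 : k - j = (k - (j + 1)) + 1 := by omega
        rw [h4] at h3
        rcases hlt (k - (j + 1)) (card_pos.1 (by omega)) with h5 | h5 <;> omega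
    have h6 : ∑ j ∈ range (k + 1), (j + 2) ≤ ∑ t ∈ range (k + 1), #(level m t) := by
      rw [← sum_range_reflect (fun t => #(level m t))]
      refine sum_le_sum fun j hj => ?_
      rw [mem_range] at hj
      have := key j (by omega)
      rwa [show k + 1 - 1 - j = k - j by omega]
    have h7 : (∑ j ∈ range (k + 1), (j + 2)) * 2 = (k + 1) * (k + 4) := by
      rw [sum_add_distrib, add_mul, sum_range_id_mul_two]
      simp
      ring
    nlinarith
  · have hle : ∀ w, m.count w ≤ k + 1 := by
      intro w
      by_contra! hw
      have h3 : (level m (k + 1)).Nonempty := ⟨w, mem_level.2 hw⟩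
      have := card_pos.2 h3
      rcases hlt k h3 with h | h <;> omega
    rw [← card_eq_sum_card_level m _ hle]
    exact hp

theorem sum_range_tsub_mul_two_le (s T : ℕ) : (∑ t ∈ range T, (s - t)) * 2 ≤ s * (s + 1) := by
  induction T generalizing s with
  | zero => simp
  | succ T ih =>
    rw [sum_range_succ']
    rcases s with - | s
    · simp
    · have := ih s
      simp only [Nat.add_sub_add_right, Nat.sub_zero]
      nlinarith

/-- Successive levels shrink strictly from the support size `s`, so the total is at most `s (s + 1)
/ 2`; a zero value gives `s + 1 ≤ card ι`. -/
theorem two_mul_sum_le_of_gapless {ι : Type*} [Fintype ι] (g : ι → ℕ)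
    (hg : ∀ i t, 1 ≤ t → t < g i → ∃ j, g j = t) (h0 : ∃ j, g j = 0) :
    2 * ∑ i, g i ≤ Fintype.card ι * #{i | 0 < g i} := by
  set s := #{i | 0 < g i} with hs
  have hsc : s + 1 ≤ Fintype.card ι := by
    obtain ⟨j, hj⟩ := h0
    rw [Nat.succ_le_iff]
    apply Finset.card_lt_univ_of_notMem (x := j)
    simp [hj]
  have hrow : ∀ t, #{i | t < g i} ≤ s - t := by
    intro t
    induction t with
    | zero => exact le_rfl
    | succ t ih =>
      by_cases he : ({i | t + 1 < g i} : Finset ι).Nonempty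
      · obtain ⟨i, hi⟩ := he
        obtain ⟨j, hj⟩ := hg i (t + 1) (by omega) (by simpa using hi)
        have : #{i | t + 1 < g i} < #{i | t < g i} := by
          apply card_lt_card
          rw [Finset.ssubset_iff_of_subset (fun x hx => by
            simp only [mem_filter, mem_univ, true_and] at *; omega)]
          exact ⟨j, by simp; omega, by simp; omega⟩
        omega
      · rw [not_nonempty_iff_eq_empty.1 he]
        simp
  rw [sum_eq_sum_card_lt univ g (∑ i, g i) fun i hi => single_le_sum (by simp) hi]
  have h1 := sum_range_tsub_mul_two_le s (∑ i, g i)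
  have h2 : ∑ t ∈ range (∑ i, g i), #{i | t < g i} ≤ ∑ t ∈ range (∑ i, g i), (s - t) :=
    sum_le_sum fun t _ => hrow t
  have h3 := Nat.mul_le_mul_left s hsc
  nlinarith

theorem Gapless.exists_lt_count_eq (hq : q.Prime) (hr : r ^ q = 1)
    {m : Multiset (ZMod p)} (hm : Gapless r m) {w : ZMod p} (hw : ∃ i : ℕ, r ^ i * w ∉ m)
    (j t : ℕ) (ht : 1 ≤ t) (htj : t < m.count (r ^ j * w)) :
    ∃ i : Fin q, m.count (r ^ (i : ℕ) * w) = t := by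
  obtain ⟨i₀, hi₀⟩ := hw
  have : ∃ i : ℕ, m.count (r ^ i * w) = t := by
    rcases hm.2 _ t ht htj with ⟨i, hi⟩ | h
    · rw [← mul_assoc, ← pow_add] at hi
      exact ⟨_, hi⟩
    · exfalso
      -- The exponent `(q - 1) * j` undoes `r ^ j`, leading back to the orbit point of multiplicity
      -- zero.
      have h1 := h (i₀ + (q - 1) * j)
      rw [← mul_assoc, ← pow_add, add_assoc, ← Nat.succ_mul, Nat.succ_eq_add_one,
        Nat.sub_add_cancel hq.one_le, pow_add, pow_mul, hr, one_pow, mul_one,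
        Multiset.count_eq_zero.2 hi₀] at h1
      omega
  obtain ⟨i, hi⟩ := this
  exact ⟨⟨i % q, Nat.mod_lt _ hq.pos⟩, by rw [pow_mul_mod hr, hi]⟩

theorem Gapless.hasShortZeroSum (hq : q.Prime) (hr : r ^ q = 1) (hr1 : r ≠ 1)
    {m : Multiset (ZMod p)} (hm : Gapless r m) (hp : p ≤ m.card) : HasShortZeroSum q m := by
  by_cases hbrick : ∃ w, ∀ i : ℕ, r ^ i * w ∈ m
  · obtain ⟨w, hw⟩ := hbrick
    exact hasShortZeroSum_of_forall_pow_mul_mem hq hr hr1 hm.1 hw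
  push Not at hbrick
  apply hasShortZeroSum_of_levels hm.1
  rw [← card_eq_sum_card_level m q ?_]
  · exact hp
  intro w
  -- A multiplicity above `q` would force the `q + 1` values `0, …, q` on an orbit of `q` points.
  by_contra! hw
  have h1 : range (q + 1) ⊆ univ.image fun i : Fin q => m.count (r ^ (i : ℕ) * w) := by
    intro t ht
    rw [mem_range] at ht
    rcases Nat.eq_zero_or_pos t with rfl | ht0
    · obtain ⟨i, hi⟩ := hbrick w
      refine mem_image.2 ⟨⟨i % q, Nat.mod_lt _ hq.pos⟩, mem_univ _, ?_⟩
      rw [pow_mul_mod hr, Multiset.count_eq_zero.2 hi]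
    · obtain ⟨i, hi⟩ := hm.exists_lt_count_eq hq hr (hbrick w) 0 t ht0 (by simp; omega)
      exact mem_image.2 ⟨i, mem_univ _, hi⟩
  have h2 := (card_le_card h1).trans card_image_le
  simp at h2

theorem Gapless.hasShortZeroSum_of_two_mul (hq : q.Prime) (hq2 : 2 < q) (hqp : q ∣ p - 1)
    (hr : r ^ q = 1) (hr1 : r ≠ 1) {m : Multiset (ZMod p)} (hm : Gapless r m)
    (hp : p + q * (q - 2) ≤ 2 * m.card) : HasShortZeroSum q m := by
  have hp1 := (Fact.out : p.Prime).one_lt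
  by_cases hbrick : ∃ w, ∀ i : ℕ, r ^ i * w ∈ m
  · obtain ⟨w, hw⟩ := hbrick
    exact hasShortZeroSum_of_forall_pow_mul_mem hq hr hr1 hm.1 hw
  push Not at hbrick
  have hr0 : r ≠ 0 := by
    rintro rfl
    rw [zero_pow hq.ne_zero] at hr
    exact zero_ne_one hr
  have horb : ∀ w, 2 * ∑ i : Fin q, m.count (r ^ (i : ℕ) * w) ≤
      q * #{i : Fin q | 0 < m.count (r ^ (i : ℕ) * w)} := by
    intro w
    have h := two_mul_sum_le_of_gapless (fun i : Fin q => m.count (r ^ (i : ℕ) * w))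
      (fun i t ht htj => hm.exists_lt_count_eq hq hr (hbrick w) i t ht htj) (by
        obtain ⟨i, hi⟩ := hbrick w
        refine ⟨⟨i % q, Nat.mod_lt _ hq.pos⟩, ?_⟩
        rw [pow_mul_mod hr, Multiset.count_eq_zero.2 hi])
    rwa [Fintype.card_fin] at h
  have hbij : ∀ (g : ZMod p → ℕ) (i : Fin q), ∑ w, g (r ^ (i : ℕ) * w) = ∑ w, g w := fun g i =>
    Equiv.sum_comp (Equiv.mulLeft₀ (r ^ (i : ℕ)) (pow_ne_zero _ hr0)) g
  have hsum := sum_le_sum fun w (_ : w ∈ (univ : Finset (ZMod p))) => horb w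
  simp_rw [← mul_sum, card_filter] at hsum
  rw [sum_comm, sum_comm (f := fun w (i : Fin q) =>
    if 0 < m.count (r ^ (i : ℕ) * w) then 1 else 0)] at hsum
  simp_rw [hbij (fun w => m.count w), hbij (fun w => if 0 < m.count w then 1 else 0)] at hsum
  rw [← card_filter, Multiset.sum_count_eq_card (s := univ) (fun a _ => mem_univ a)] at hsum
  simp only [sum_const, card_univ, Fintype.card_fin, smul_eq_mul] at hsum
  change 2 * (q * m.card) ≤ q * (q * #(level m 0)) at hsum
  have hlev : 2 * m.card ≤ q * #(level m 0) := by
    have := hq.pos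
    nlinarith
  obtain ⟨s, hs⟩ := hqp
  have hs' : p = q * s + 1 := by omega
  obtain ⟨q', rfl⟩ : ∃ q', q = q' + 2 := ⟨q - 2, by omega⟩
  -- Averaging over orbits gave `2 |m| ≤ q |supp m|`. With `0` adjoined, the support reaches the
  -- size `s + q` at which `q` distinct residues with sum zero exist.
  have hcard : s + q' + 1 ≤ #(level m 0) := by
    by_contra! hcon
    have h1 := Nat.mul_le_mul_left (q' + 2) (show #(level m 0) ≤ s + q' by omega)
    simp only [Nat.add_sub_cancel] at hp
    nlinarith
  have h0 : (0 : ZMod p) ∉ level m 0 := fun h => hm.1 (Multiset.count_pos.1 (mem_level.1 h))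
  obtain ⟨A, hA, hAc⟩ := exists_subset_card_eq (s := insert 0 (level m 0)) (n := s + (q' + 2))
    (by rw [card_insert_of_notMem h0]; omega)
  obtain ⟨B, hB, hBc, hBs⟩ := exists_card_eq_sum_eq_zero (n := q' + 2) A (by omega) (by
    rw [hAc, hs]
    ring)
  refine ⟨(B.erase 0).val, ?_, ?_, ?_, ?_⟩
  · rw [Multiset.le_iff_subset (Finset.nodup _)]
    intro x hx
    obtain ⟨hx0, hxB⟩ := mem_erase.1 hx
    have := (mem_insert.1 (hA (hB hxB))).resolve_left hx0
    exact Multiset.count_pos.1 (mem_level.1 this)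
  · rw [Ne, val_eq_zero, ← card_eq_zero]
    have := pred_card_le_card_erase (s := B) (a := 0)
    omega
  · rw [sum_val, sum_erase (f := id) _ (id_eq (0 : ZMod p))]
    exact hBs
  · exact (card_erase_le).trans hBc.le

end Gapless

/-! ### Reduction to gapless multisets. -/

section Spread

open Finset

variable {p : ℕ} [Fact p.Prime] {q : ℕ} {r : ZMod p}

/-- The cardinalities of the levels of `m`, ordered lexicographically. -/
def profile (m : Multiset (ZMod p)) : Lex (ℕ → ℕ) := toLex fun t => #(level m t)

/-- The first level whose size changes decides, and it lies below `t`; higher levels may shrink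
freely. -/
theorem profile_lt_profile {m n : Multiset (ZMod p)} {t : ℕ}
    (h : ∀ s < t, level m s ⊆ level n s) {s : ℕ} (hs : s < t) {y : ZMod p} (hm : y ∉ level m s)
    (hn : y ∈ level n s) : profile m < profile n := by
  classical
  have hne : ∃ s, s < t ∧ #(level m s) ≠ #(level n s) := ⟨s, hs, fun he => hm (by
    rwa [eq_of_subset_of_card_le (h s hs) he.ge])⟩
  obtain ⟨h1, h2⟩ := Nat.find_spec hne
  refine ⟨Nat.find hne, fun j hj => ?_, ?_⟩
  · by_contra hcon
    exact Nat.find_min hne hj ⟨hj.trans h1, hcon⟩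
  · exact lt_of_le_of_ne (card_le_card (h _ h1)) h2

/-- As `t` is invertible modulo `q`, a set stable under `r ^ t` would contain whole orbits. -/
theorem exists_pow_mul_notMem (hq : q.Prime) (hr : r ^ q = 1) {T : Finset (ZMod p)} {w z : ZMod p}
    (hw : w ∈ T) {i : ℕ} (hz : z = r ^ i * w) (hzT : z ∉ T) {t : ℕ} (ht0 : 0 < t) (htq : t < q) :
    ∃ x ∈ T, r ^ t * x ∉ T := by
  by_contra! hcon
  have h1 : ∀ j : ℕ, r ^ (t * j) * w ∈ T := by
    intro j
    induction j with
    | zero => simpa using hw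
    | succ j ih =>
      have := hcon _ ih
      rwa [← mul_assoc, ← pow_add, add_comm, ← Nat.mul_succ] at this
  obtain ⟨j, -, hj⟩ := Nat.exists_mul_mod_eq_of_coprime i
    (Nat.coprime_of_lt_prime ht0.ne' htq hq).symm hq.ne_zero
  apply hzT
  rw [hz, ← pow_mul_mod hr i w, ← hj, pow_mul_mod hr]
  exact h1 j

/-- The dichotomy behind the reduction to gapless multisets: a long multiset either has a long
gapless submultiset, or a zero-sum submultiset all whose translates spread it further. -/
theorem exists_gapless_or_exists_profile_lt (hq : q.Prime) (hr : r ^ q = 1)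
    {m : Multiset (ZMod p)} (h0 : 0 ∉ m) {N : ℕ} (hN : N + p ≤ m.card + 1) :
    (∃ n ≤ m, Gapless r n ∧ N ≤ n.card) ∨ ∃ u v, u ≠ 0 ∧ v ≠ 0 ∧ u + v = m ∧ u.sum = 0 ∧
      ∀ t, 0 < t → t < q → profile m < profile (u.map (r ^ t * ·) + v) := by
  classical
  have hp := (Fact.out : p.Prime).one_lt
  by_cases hgap : Gapless r m
  · exact Or.inl ⟨m, le_rfl, hgap, by omega⟩
  have hex : ∃ t, 1 ≤ t ∧ ∃ w, t < m.count w ∧ (∀ i : ℕ, m.count (r ^ i * w) ≠ t) ∧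
      ∃ i : ℕ, m.count (r ^ i * w) < t := by
    by_contra! hcon
    refine hgap ⟨h0, fun w t ht htw => ?_⟩
    by_cases h1 : ∃ i : ℕ, m.count (r ^ i * w) = t
    · exact Or.inl h1
    · exact Or.inr (hcon t ht w htw (by simpa using h1))
  -- Take the least multiplicity `t` that is skipped by some orbit, so that gaplessness holds below
  -- `t`.
  obtain ⟨ht1, w, hw, hwt, i₀, hi₀⟩ := Nat.find_spec hex
  have hmin : ∀ s, s < Nat.find hex → 1 ≤ s → ∀ w, s < m.count w →
      (∃ i : ℕ, m.count (r ^ i * w) = s) ∨ ∀ i : ℕ, s ≤ m.count (r ^ i * w) := by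
    intro s hs hs1 w hsw
    by_contra! hcon
    exact Nat.find_min hex hs ⟨hs1, w, hsw, hcon⟩
  generalize Nat.find hex = t at *
  set T : Finset (ZMod p) := {x | t < m.count x ∧ ∃ i : ℕ, x = r ^ i * w} with hT
  have hmemT : ∀ x, x ∈ T ↔ t < m.count x ∧ ∃ i : ℕ, x = r ^ i * w := fun x => by simp [hT]
  have hwT : w ∈ T := (hmemT w).2 ⟨hw, 0, by simp⟩
  have hcountT : ∀ x, T.val.count x = if x ∈ T then 1 else 0 := fun x =>
    Multiset.count_eq_of_nodup T.nodup
  set n₀ := ∑ s ∈ range t, (level m s).val with hn₀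
  have hn₀m : n₀ ≤ m := sum_level_le m t
  have hcn₀ : ∀ x, n₀.count x = min t (m.count x) := count_sum_level m t
  set l := m - n₀ with hl
  have hnl : n₀ + l = m := add_tsub_cancel_of_le hn₀m
  have hcl : ∀ x, l.count x = m.count x - min t (m.count x) := fun x => by
    rw [hl, Multiset.count_sub, hcn₀]
  have hTl : T.val ≤ l := by
    rw [Multiset.le_iff_count]
    intro x
    rw [hcountT, hcl]
    split_ifs with hx
    · have := ((hmemT x).1 hx).1
      omega
    · omega
  have hcard : n₀.card + l.card = m.card := by rw [← Multiset.card_add, hnl]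
  -- Then the excess `l` over multiplicity `t` has `p - 1` elements outside `T`, enough to complete
  -- `T` to a zero-sum.
  by_cases hlc : p + #T ≤ l.card + 1
  · right
    have h0' : (0 : ZMod p) ∉ l - T.val := fun h =>
      h0 (Multiset.mem_of_le ((tsub_le_self).trans (hnl ▸ Multiset.le_add_left _ _)) h)
    have hlT : (l - T.val).card = l.card - #T := Multiset.card_sub hTl
    obtain ⟨u', hu', hus⟩ := exists_le_sum_eq (l - T.val) h0' (by omega) (-T.val.sum)
    have hul : T.val + u' ≤ l := by
      rw [← add_tsub_cancel_of_le hTl]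
      exact add_le_add le_rfl hu'
    have hv : n₀ ≤ m - (T.val + u') := by
      rw [← hnl]
      exact le_tsub_of_add_le_right (add_le_add le_rfl hul)
    refine ⟨T.val + u', m - (T.val + u'), ?_, ?_, ?_, ?_, ?_⟩
    · intro h
      have : w ∈ T.val + u' := Multiset.mem_add.2 (Or.inl hwT)
      rw [h] at this
      exact Multiset.notMem_zero w this
    · intro h
      rw [h] at hv
      have h1 : w ∈ n₀ := Multiset.count_pos.1 (by rw [hcn₀]; omega)
      exact Multiset.notMem_zero w (Multiset.mem_of_le hv h1)
    · exact add_tsub_cancel_of_le (hul.trans (hnl ▸ Multiset.le_add_left _ _))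
    · rw [Multiset.sum_add, hus, add_neg_cancel]
    · intro s hs0 hsq
      obtain ⟨x, hxT, hxs⟩ := exists_pow_mul_notMem hq hr hwT (z := r ^ i₀ * w) rfl
        (fun h => by have := ((hmemT _).1 h).1; omega) hs0 hsq
      obtain ⟨hxt, i, rfl⟩ := (hmemT x).1 hxT
      -- The translate leaves `T` and `t` is skipped, so its multiplicity is below `t`. It is then
      -- absent from `l`, keeps all its copies in `v`, and gains one from the translation.
      have hyt : m.count (r ^ s * (r ^ i * w)) < t := by
        by_contra! hcon
        apply hxs
        have h1 := hwt (s + i)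
        rw [pow_add, mul_assoc] at h1
        exact (hmemT _).2 ⟨by omega, s + i, by rw [pow_add, mul_assoc]⟩
      set y := r ^ s * (r ^ i * w) with hy
      have hyu : (T.val + u').count y = 0 := by
        have h1 := Multiset.count_le_of_le y hul
        rw [hcl] at h1
        omega
      have hyv : (m - (T.val + u')).count y = m.count y := by
        rw [Multiset.count_sub, hyu, Nat.sub_zero]
      have hyu' : 1 ≤ ((T.val + u').map (r ^ s * ·)).count y := by
        rw [Nat.one_le_iff_ne_zero, Multiset.count_ne_zero]
        exact Multiset.mem_map.2 ⟨_, Multiset.mem_add.2 (Or.inl hxT), rfl⟩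
      refine profile_lt_profile (t := t) (fun j hj z hz => ?_) hyt (y := y) ?_ ?_
      · rw [mem_level] at *
        have h1 := Multiset.count_le_of_le z hv
        rw [hcn₀] at h1
        rw [Multiset.count_add]
        omega
      · rw [mem_level]
        omega
      · rw [mem_level, Multiset.count_add]
        omega
  · left
    have hcTw : ∀ x, (T.erase w).val.count x = if x ∈ T.erase w then 1 else 0 := fun x =>
      Multiset.count_eq_of_nodup (T.erase w).nodup
    -- Erasing `w` from `T` supplies the missing value `t`, and `t + 1` is now the largest possible
    -- multiplicity.
    refine ⟨n₀ + (T.erase w).val, ?_, ⟨?_, ?_⟩, ?_⟩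
    · rw [← hnl]
      exact add_le_add le_rfl ((Finset.val_le_iff.2 (erase_subset w T)).trans hTl)
    · intro h
      rcases Multiset.mem_add.1 h with h | h
      · exact h0 (Multiset.mem_of_le hn₀m h)
      · have := ((hmemT 0).1 (mem_of_mem_erase (Finset.mem_def.2 h))).1
        exact h0 (Multiset.count_pos.1 (by omega))
    · intro x s hs hsx
      simp only [Multiset.count_add, hcn₀, hcTw] at hsx ⊢
      have hTt : ∀ y ∈ T.erase w, t < m.count y := fun y hy =>
        ((hmemT y).1 (mem_of_mem_erase hy)).1
      rcases lt_trichotomy s t with hst | rfl | hst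
      · have hsm : s < m.count x := by
          split_ifs at hsx with hx
          · have := hTt x hx
            omega
          · omega
        rcases hmin s hst hs x hsm with ⟨i, hi⟩ | h
        · left
          refine ⟨i, ?_⟩
          rw [if_neg (fun h => by have := hTt _ h; omega)]
          omega
        · right
          intro i
          have := h i
          omega
      · left
        have hx : x ∈ T.erase w := by
          by_contra hx
          rw [if_neg hx] at hsx
          omega
        obtain ⟨-, i, rfl⟩ := (hmemT x).1 (mem_of_mem_erase hx)
        refine ⟨(q - 1) * i, ?_⟩
        have : r ^ ((q - 1) * i) * (r ^ i * w) = w := by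
          rw [← mul_assoc, ← pow_add, ← Nat.succ_mul, Nat.succ_eq_add_one,
            Nat.sub_add_cancel hq.one_le, pow_mul, hr, one_pow, one_mul]
        rw [this, if_neg (notMem_erase w T)]
        omega
      · exfalso
        split_ifs at hsx <;> omega
    · rw [Multiset.card_add]
      have h1 : (T.erase w).val.card = #T - 1 := card_erase_of_mem hwT
      have h2 : 0 < #T := card_pos.2 ⟨w, hwT⟩
      omega

/-- `Z` is closed under the relation that the sum of all translates of a zero-sum submultiset of
a multiset of cardinality `d` vanishes. -/
def OrbitClosed (q : ℕ) (r : ZMod p) (d : ℕ) (Z : Multiset (ZMod p) → Prop) : Prop :=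
  ∀ u v, u ≠ 0 → v ≠ 0 → u.card + v.card = d → u.sum = 0 →
    (∀ t, 0 < t → t < q → Z (u.map (r ^ t * ·) + v)) → Z (u + v)

/-- Induction from larger to smaller profiles among the finitely many multisets of cardinality `d`:
without a short zero-sum, all the other translates have larger profile. -/
theorem OrbitClosed.of_hasShortZeroSum (hq : q.Prime) (hr : r ^ q = 1) {d N k : ℕ}
    {Z : Multiset (ZMod p) → Prop} (hZ : OrbitClosed q r d Z) (hk : 1 ≤ k) (hd : N + p ≤ d + 1)
    (hN : ∀ n, Gapless r n → N ≤ n.card → HasShortZeroSum k n)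
    (hshort : ∀ m, m.card = d → HasShortZeroSum k m → Z m) (m : Multiset (ZMod p))
    (hm : m.card = d) : Z m := by
  have hwf : WellFounded fun a b : Sym (ZMod p) d =>
      profile (b : Multiset (ZMod p)) < profile (a : Multiset (ZMod p)) := by
    have : IsTrans (Sym (ZMod p) d) fun a b =>
        profile (b : Multiset (ZMod p)) < profile (a : Multiset (ZMod p)) :=
      ⟨fun a b c h1 h2 => h2.trans h1⟩
    have : Std.Irrefl fun a b : Sym (ZMod p) d =>
        profile (b : Multiset (ZMod p)) < profile (a : Multiset (ZMod p)) :=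
      ⟨fun a => lt_irrefl _⟩
    exact Finite.wellFounded_of_trans_of_irrefl _
  have key : ∀ s : Sym (ZMod p) d, Z s := by
    intro s
    induction s using hwf.induction with
    | h s ih =>
      by_cases h0 : (0 : ZMod p) ∈ (s : Multiset (ZMod p))
      · exact hshort _ s.2 (hasShortZeroSum_of_zero_mem hk h0)
      rcases exists_gapless_or_exists_profile_lt (N := N) hq hr h0 (by rw [Sym.card_coe]; exact hd)
        with ⟨n, hns, hgap, hn⟩ | ⟨u, v, hu, hv, huv, hus, hlt⟩
      · exact hshort _ s.2 ((hN n hgap hn).mono le_rfl hns)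
      · have hc : u.card + v.card = d := by
          rw [← Multiset.card_add, huv]
          exact s.2
        rw [← huv]
        refine hZ u v hu hv hc hus fun t ht htq => ?_
        exact ih ⟨_, by rw [Multiset.card_add, Multiset.card_map, hc]⟩ (hlt t ht htq)
  exact key ⟨m, hm⟩

/-- Pieces already split off join the untranslated part, so they survive the later spreading. -/
theorem OrbitClosed.add_left {d e : ℕ} {Z : Multiset (ZMod p) → Prop} (hZ : OrbitClosed q r d Z)
    (U : Multiset (ZMod p)) (hU : U.card + e = d) :
    OrbitClosed q r e fun m => Z (U + m) := by
  intro u v hu hv huv hus h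
  have := hZ u (U + v) hu (by simp [hv]) (by rw [Multiset.card_add]; omega) hus
    (fun t ht htq => by
      rw [add_left_comm]
      exact h t ht htq)
  rwa [add_left_comm] at this

/-- `Z` contains the multisets of cardinality `d` that properly contain a sum of `q` nonempty
zero-sum multisets. -/
def ProductClosed (q d : ℕ) (Z : Multiset (ZMod p) → Prop) : Prop :=
  ∀ (U : Fin q → Multiset (ZMod p)) (v : Multiset (ZMod p)), (∀ i, U i ≠ 0) →
    (∀ i, (U i).sum = 0) → v ≠ 0 → (∑ i, U i).card + v.card = d → Z (∑ i, U i + v)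

/-- Multisets from which `q` zero-sum submultisets can be split off, the first `q - 1` of them
with at most `k` elements after a reduction to gapless multisets. -/
theorem OrbitClosed.forall_of_card (hq : q.Prime) (hr : r ^ q = 1) {d N k : ℕ}
    {Z : Multiset (ZMod p) → Prop} (hZ : OrbitClosed q r d Z)
    (hprod : ProductClosed q d Z) (hk : 1 ≤ k) (hNk : k + 2 ≤ N) (hd : (q - 2) * k + N + p ≤ d + 1)
    (hN : ∀ n, Gapless r n → N ≤ n.card → HasShortZeroSum k n) (m : Multiset (ZMod p))
    (hm : m.card = d) : Z m := by
  have hq2 := hq.two_le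
  -- Here `j` counts the short pieces still to be split off.
  have key : ∀ j ≤ q - 1, ∀ U : Fin (q - 1 - j) → Multiset (ZMod p), (∀ i, U i ≠ 0) →
      (∀ i, (U i).sum = 0) → (∀ i, (U i).card ≤ k) → ∀ v : Multiset (ZMod p),
      (∑ i, U i).card + v.card = d → Z (∑ i, U i + v) := by
    intro j
    induction j with
    | zero =>
      intro _ U hU0 hUs hUk v hv
      have hUc : (∑ i, U i).card ≤ (q - 1) * k := by
        rw [Multiset.card_sum]
        refine (sum_le_sum fun i _ => hUk i).trans ?_
        simp
      have hq1 : (q - 1) * k = (q - 2) * k + k := by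
        rw [← Nat.succ_mul]
        congr 1
        omega
      -- The condition `k + 2 ≤ N` leaves one element more than the last zero-sum piece can use, so
      -- the final remainder is nonempty.
      have hvp : p + 1 ≤ v.card := by omega
      obtain ⟨u, hu, hu0, hus, huc⟩ := hasShortZeroSum_of_le_card (p := p) (m := v) (by omega)
      obtain ⟨v, rfl⟩ := Multiset.le_iff_exists_add.1 hu
      rw [Multiset.card_add] at hvp hv
      obtain ⟨q', rfl⟩ : ∃ q', q = q' + 1 := ⟨q - 1, by omega⟩
      have h := hprod (Fin.cons u U : Fin (q' + 1) → Multiset (ZMod p)) v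
        (fun i => by refine Fin.cases ?_ (fun i => ?_) i; exacts [hu0, hU0 i])
        (fun i => by refine Fin.cases ?_ (fun i => ?_) i; exacts [hus, hUs i])
        (by rintro rfl; simp at hvp; omega)
        (by
          rw [Fin.sum_univ_succ, Multiset.card_add]
          simp only [Fin.cons_zero, Fin.cons_succ]
          have : (∑ i : Fin q', U i).card + (u.card + v.card) = d := hv
          omega)
      rw [Fin.sum_univ_succ] at h
      simp only [Fin.cons_zero, Fin.cons_succ] at h
      rw [add_comm u, add_assoc] at h
      exact h
    | succ j ih =>
      intro hj U hU0 hUs hUk v hv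
      have hUc : (∑ i, U i).card ≤ (q - 2) * k := by
        rw [Multiset.card_sum]
        refine (sum_le_sum fun i _ => hUk i).trans ?_
        rw [sum_const, card_univ, Fintype.card_fin, smul_eq_mul]
        exact Nat.mul_le_mul_right k (by omega)
      refine (hZ.add_left (∑ i, U i) hv).of_hasShortZeroSum hq hr (N := N) (k := k) hk (by omega)
        hN (fun m' hm' hs => ?_) v rfl
      obtain ⟨u, hu, hu0, hus, huc⟩ := hs
      obtain ⟨v', rfl⟩ := Multiset.le_iff_exists_add.1 hu
      have hidx : q - 1 - j = (q - 1 - (j + 1)) + 1 := by omega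
      have h := ih (by omega)
      rw [hidx] at h
      have h2 := h (Fin.cons u U : Fin _ → Multiset (ZMod p))
        (fun i => by refine Fin.cases ?_ (fun i => ?_) i; exacts [hu0, hU0 i])
        (fun i => by refine Fin.cases ?_ (fun i => ?_) i; exacts [hus, hUs i])
        (fun i => by refine Fin.cases ?_ (fun i => ?_) i; exacts [huc, hUk i]) v'
        (by
          rw [Fin.sum_univ_succ, Multiset.card_add]
          simp only [Fin.cons_zero, Fin.cons_succ]
          rw [Multiset.card_add] at hm'
          omega)
      rw [Fin.sum_univ_succ] at h2
      simp only [Fin.cons_zero, Fin.cons_succ] at h2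
      rw [add_comm u, add_assoc] at h2
      exact h2
  have h := key (q - 1) le_rfl
  rw [Nat.sub_self] at h
  have h2 := h Fin.elim0 (fun i => i.elim0) (fun i => i.elim0) (fun i => i.elim0) m (by simpa using hm)
  simpa using h2

/-- The degrees in which every multiset of weights lies in each class that is closed under the
orbit relation and contains the products of `q` zero-sum multisets. -/
def IsReducible (q : ℕ) (r : ZMod p) (d : ℕ) : Prop :=
  ∀ Z : Multiset (ZMod p) → Prop, OrbitClosed q r d Z → ProductClosed q d Z →
    ∀ m : Multiset (ZMod p), m.card = d → Z m

theorem two_mul_add_one_le (hp2 : Odd p) (hq2 : Odd q) (hqp : q ∣ p - 1) : 2 * q + 1 ≤ p := by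
  obtain ⟨s, hs⟩ := hqp
  have hp := (Fact.out : p.Prime).one_lt
  rcases s with - | - | s
  · omega
  · rw [zero_add, mul_one] at hs
    obtain ⟨a, rfl⟩ := hp2
    obtain ⟨b, rfl⟩ := hq2
    omega
  · have : q * (s + 1 + 1) = q * s + 2 * q := by ring
    omega

theorem isReducible_of_le (hq : q.Prime) (hp2 : Odd p) (hq2 : Odd q) (hqp : q ∣ p - 1)
    (hr : r ^ q = 1) (hr1 : r ≠ 1) {d : ℕ} (hd : 2 * p + (q - 2) * q ≤ d + 1) :
    IsReducible q r d := fun Z hZ hprod => by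
  have := two_mul_add_one_le hp2 hq2 hqp
  have := hq.two_le
  exact hZ.forall_of_card hq hr hprod (N := p) (k := q) (by omega)
    (by obtain ⟨b, rfl⟩ := hq2; omega) (by omega)
    fun n hn hc => hn.hasShortZeroSum hq hr hr1 hc

/-- With `k = q` and `2 N = p + q (q - 2)`, the required degree `(q - 2) q + N + p` is `3 N`. -/
theorem isReducible_of_two_mul_le (hq : q.Prime) (hp2 : Odd p) (hq2 : Odd q) (hqp : q ∣ p - 1)
    (hr : r ^ q = 1) (hr1 : r ≠ 1) (hpq : q * (q - 2) < p) {d : ℕ}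
    (hd : 3 * (p + q * (q - 2)) ≤ 2 * (d + 1)) : IsReducible q r d := fun Z hZ hprod => by
  have h1 := two_mul_add_one_le hp2 hq2 hqp
  have h2 := hq.two_le
  have heven : Even (p + q * (q - 2)) := by
    refine hp2.add_odd (hq2.mul ?_)
    obtain ⟨b, rfl⟩ := hq2
    exact ⟨b - 1, by omega⟩
  obtain ⟨N, hN⟩ := heven
  have hq3 : 3 ≤ q := by
    obtain ⟨b, rfl⟩ := hq2
    omega
  refine hZ.forall_of_card hq hr hprod (N := N) (k := q) (by omega) ?_ ?_
    fun n hn hc => hn.hasShortZeroSum_of_two_mul hq (by omega) hqp hr hr1 (by omega)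
  · obtain ⟨b, rfl⟩ : ∃ b, q = b + 3 := ⟨q - 3, by omega⟩
    rw [show b + 3 - 2 = b + 1 by omega] at *
    nlinarith
  · rw [mul_comm]
    omega

theorem isReducible_of_lt_mul (hq : q.Prime) (hp2 : Odd p) (hq2 : Odd q) (hqp : q ∣ p - 1)
    (hr : r ^ q = 1) (hr1 : r ≠ 1) {c : ℕ} (hcq : c ≤ q) (hpc : 2 * p < c * (c + 1)) {d : ℕ}
    (hd : 2 * p + (q - 2) * (c - 1) ≤ d + 1) : IsReducible q r d := fun Z hZ hprod => by
  have h1 := two_mul_add_one_le hp2 hq2 hqp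
  have h2 := hq.two_le
  have hc : 2 ≤ c := by
    by_contra! hc
    have : c * (c + 1) ≤ 1 * (1 + 1) := Nat.mul_le_mul (by omega) (by omega)
    omega
  exact hZ.forall_of_card hq hr hprod (N := p) (k := c - 1) (by omega) (by omega) (by omega)
    fun n hn hp => hn.hasShortZeroSum_pred hq hr hr1 hc hcq hpc hp

end Spread

/-! ### From multisets of weights to monomials. -/

section Monomials

open Finset

theorem Multiset.exists_le_map_eq {α β : Type*} {f : α → β} {m : Multiset α} {u : Multiset β}
    (h : u ≤ m.map f) : ∃ a ≤ m, a.map f = u := by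
  induction u using Multiset.induction generalizing m with
  | empty => exact ⟨0, Multiset.zero_le m, rfl⟩
  | cons y u ih =>
    obtain ⟨x, hx, rfl⟩ := Multiset.mem_map.1 (Multiset.mem_of_le h (Multiset.mem_cons_self y u))
    obtain ⟨m, rfl⟩ := Multiset.exists_cons_of_mem hx
    rw [Multiset.map_cons, Multiset.cons_le_cons_iff] at h
    obtain ⟨a, ha, rfl⟩ := ih h
    exact ⟨x ::ₘ a, Multiset.cons_le_cons x ha, Multiset.map_cons _ _ _⟩

theorem Multiset.exists_add_of_map_eq_add {α β : Type*} {f : α → β} {m : Multiset α}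
    {u v : Multiset β} (h : m.map f = u + v) : ∃ a b, a + b = m ∧ a.map f = u ∧ b.map f = v := by
  obtain ⟨a, ha, hau⟩ := Multiset.exists_le_map_eq (h ▸ Multiset.le_add_right u v)
  obtain ⟨b, rfl⟩ := Multiset.le_iff_exists_add.1 ha
  refine ⟨a, b, rfl, hau, ?_⟩
  rw [Multiset.map_add, hau] at h
  exact add_left_cancel h

theorem Multiset.exists_sum_add_of_map_eq {α β ι : Type*} {f : α → β} (s : Finset ι)
    {m : Multiset α} {U : ι → Multiset β} {v : Multiset β} (h : m.map f = ∑ i ∈ s, U i + v) :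
    ∃ (A : ι → Multiset α) (b : Multiset α), ∑ i ∈ s, A i + b = m ∧ (∀ i ∈ s, (A i).map f = U i) ∧
      b.map f = v := by
  classical
  induction s using Finset.induction generalizing m with
  | empty => exact ⟨fun _ => 0, m, by simp, by simp, by simpa using h⟩
  | insert i s hi ih =>
    rw [sum_insert hi, add_assoc] at h
    obtain ⟨a, m', rfl, ha, hm'⟩ := Multiset.exists_add_of_map_eq_add h
    obtain ⟨A, b, rfl, hA, hb⟩ := ih hm'
    refine ⟨Function.update A i a, b, ?_, ?_, hb⟩
    · rw [sum_insert hi, Function.update_self, add_assoc,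
        sum_congr rfl fun j hj => Function.update_of_ne (ne_of_mem_of_not_mem hj hi) a A]
    · intro j hj
      rcases Finset.mem_insert.1 hj with rfl | hj
      · rwa [Function.update_self]
      · rw [Function.update_of_ne (ne_of_mem_of_not_mem hj hi)]
        exact hA j hj

variable {p : ℕ} {q : ℕ} {r : ZMod p} {F L X : Type*} [Field F] [CommRing L]
  [Algebra F L] (R : Subalgebra F L) (β : L →ₐ[F] L) (vec : X → L) (w : X → ZMod p) (σ : X → X)

theorem pow_apply_prod_map (hσ : ∀ x, β (vec x) = vec (σ x)) (t : ℕ) (m : Multiset X) :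
    (β ^ t) (m.map vec).prod = ((m.map σ^[t]).map vec).prod := by
  have h1 : ∀ x, (β ^ t) (vec x) = vec (σ^[t] x) := by
    intro x
    induction t with
    | zero => rfl
    | succ t ih => rw [pow_succ', AlgHom.mul_apply, ih, hσ, Function.iterate_succ_apply']
  rw [map_multiset_prod, Multiset.map_map, Multiset.map_map]
  simp only [Function.comp_def, h1]

theorem weight_iterate (hw : ∀ x, w (σ x) = r * w x) (t : ℕ) (x : X) :
    w (σ^[t] x) = r ^ t * w x := by
  induction t with
  | zero => simp
  | succ t ih => rw [Function.iterate_succ_apply', hw, ih, pow_succ']; ring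

theorem sum_map_weight_iterate (hw : ∀ x, w (σ x) = r * w x) (t : ℕ) (m : Multiset X) :
    ((m.map σ^[t]).map w).sum = r ^ t * (m.map w).sum := by
  rw [Multiset.map_map, ← Multiset.sum_map_mul_left]
  simp only [Function.comp_def, weight_iterate w σ hw]

variable {vec w σ β R} [Fact p.Prime]

/-- The orbit sum of `a` is in `R` and `b` has smaller degree, so their product is in `N`;
subtracting the terms with `t ≠ 0` leaves `a b`. -/
theorem orbitClosed_of_submodule (hq : q ≠ 0) (hσ : ∀ x, β (vec x) = vec (σ x))
    (hw : ∀ x, w (σ x) = r * w x)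
    (hR : ∀ u : Multiset X, (u.map w).sum = 0 → ∑ t ∈ range q, (β ^ t) (u.map vec).prod ∈ R)
    (N : Submodule R L) (d : ℕ)
    (hN : ∀ m : Multiset X, m ≠ 0 → m.card < d → (m.map vec).prod ∈ N) :
    OrbitClosed q r d fun S => ∀ m : Multiset X, m.map w = S → (m.map vec).prod ∈ N := by
  intro u v hu hv huv hus h m hm
  obtain ⟨a, b, rfl, rfl, rfl⟩ := Multiset.exists_add_of_map_eq_add hm
  rw [Multiset.card_map, Multiset.card_map] at huv
  have ha : 0 < a.card := Multiset.card_pos.2 (by rintro rfl; exact hu rfl)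
  have hb : b ≠ 0 := by rintro rfl; exact hv rfl
  have h1 : (∑ t ∈ range q, (β ^ t) (a.map vec).prod) * (b.map vec).prod ∈ N :=
    N.smul_mem ⟨_, hR a hus⟩ (hN b hb (by omega))
  obtain ⟨q, rfl⟩ := Nat.exists_eq_succ_of_ne_zero hq
  rw [sum_range_succ', add_mul, sum_mul] at h1
  have h2 : ∑ t ∈ range q, (β ^ (t + 1)) (a.map vec).prod * (b.map vec).prod ∈ N := by
    refine sum_mem fun t ht => ?_
    rw [mem_range] at ht
    rw [pow_apply_prod_map β vec σ hσ, ← Multiset.prod_add, ← Multiset.map_add]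
    refine h (t + 1) (by omega) (by omega) _ ?_
    rw [Multiset.map_add, Multiset.map_map, Multiset.map_map]
    simp only [Function.comp_def, weight_iterate w σ hw]
  have h3 := (N.add_mem_iff_right h2).1 h1
  rw [Multiset.map_add, Multiset.prod_add]
  exact h3

/-- Benson's identity, in the form in which the terms that contain a translated factor are
collected. -/
theorem sum_powerset_orbit_sum_eq_zero (hβ : β ^ q = 1) (f : Fin q → L) :
    ∑ A ∈ (univ : Finset (Fin q)).powerset, (-1) ^ #A *
      (∑ t ∈ range q, (β ^ t) (∏ i ∈ univ \ A, (β ^ (i : ℕ)) (f i))) * ∏ i ∈ A, f i = 0 := by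
  have h1 : ∀ t ∈ range q, ∏ i : Fin q, ((β ^ t) ((β ^ (i : ℕ)) (f i)) - f i) = 0 := by
    intro t ht
    rw [mem_range] at ht
    -- The factor with index `-t` modulo `q` vanishes because `β ^ q = 1`.
    refine prod_eq_zero (mem_univ (⟨(q - t) % q, Nat.mod_lt _ (by omega)⟩ : Fin q)) ?_
    rw [← AlgHom.mul_apply, ← pow_add]
    have : β ^ (t + (q - t) % q) = 1 := by
      rcases Nat.eq_zero_or_pos t with rfl | ht0
      · simp
      · rw [Nat.mod_eq_of_lt (by omega), Nat.add_sub_cancel' ht.le, hβ]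
    rw [this, AlgHom.one_apply, sub_self]
  have h2 := sum_eq_zero h1
  simp_rw [prod_sub] at h2
  rw [sum_comm] at h2
  rw [← h2]
  refine sum_congr rfl fun A _ => ?_
  rw [mul_sum, sum_mul]
  simp_rw [map_prod]

/-- In Benson's identity times `b`, a term with `B ≠ univ` is an invariant times a shorter monomial,
nonempty thanks to `b`. The term `B = univ` is `± q` times the monomial in question. -/
theorem productClosed_of_submodule (hq : (q : F) ≠ 0) (hβ : β ^ q = 1)
    (hσ : ∀ x, β (vec x) = vec (σ x)) (hw : ∀ x, w (σ x) = r * w x)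
    (hR : ∀ u : Multiset X, (u.map w).sum = 0 → ∑ t ∈ range q, (β ^ t) (u.map vec).prod ∈ R)
    (N : Submodule R L) (d : ℕ)
    (hN : ∀ m : Multiset X, m ≠ 0 → m.card < d → (m.map vec).prod ∈ N) :
    ProductClosed q d fun S => ∀ m : Multiset X, m.map w = S → (m.map vec).prod ∈ N := by
  intro U v hU hUs hv hd m hm
  obtain ⟨A, b, rfl, hA, rfl⟩ := Multiset.exists_sum_add_of_map_eq univ hm
  have hb : b ≠ 0 := by rintro rfl; exact hv rfl
  have hA0 : ∀ i, 0 < (A i).card := fun i => Multiset.card_pos.2 (fun h => hU i (by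
    rw [← hA i (mem_univ i), h, Multiset.map_zero]))
  have hAd : ∑ i, (A i).card + b.card = d := by
    rw [← hd, Multiset.card_sum, Multiset.card_map]
    congr 1
    exact sum_congr rfl fun i _ => by rw [← hA i (mem_univ i), Multiset.card_map]
  have hmon : ∀ (B : Finset (Fin q)) (g : Fin q → Multiset X),
      ∏ i ∈ B, ((g i).map vec).prod = ((∑ i ∈ B, g i).map vec).prod := by
    intro B g
    rw [← Multiset.coe_mapAddMonoidHom, map_sum, Multiset.prod_sum]
  have key := sum_powerset_orbit_sum_eq_zero hβ fun i => ((A i).map vec).prod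
  have key2 := congrArg (· * (b.map vec).prod) key
  simp only [zero_mul, sum_mul] at key2
  have hterm : ∀ B ∈ (univ : Finset (Fin q)).powerset.erase univ, (-1) ^ #B *
      (∑ t ∈ range q, (β ^ t) (∏ i ∈ univ \ B, (β ^ (i : ℕ)) ((A i).map vec).prod)) *
      (∏ i ∈ B, ((A i).map vec).prod) * (b.map vec).prod ∈ N := by
    intro B hB
    have hBu : B ≠ univ := (mem_erase.1 hB).1
    obtain ⟨j, hj⟩ : ∃ j, j ∉ B := by
      by_contra! h
      exact hBu (eq_univ_of_forall h)
    have h1 : (∑ t ∈ range q, (β ^ t) (∏ i ∈ univ \ B, (β ^ (i : ℕ)) ((A i).map vec).prod)) ∈ R := by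
      simp_rw [pow_apply_prod_map β vec σ hσ (_ : ℕ) (A _)]
      rw [hmon (univ \ B) fun i => (A i).map σ^[(i : ℕ)]]
      apply hR
      rw [← Multiset.coe_mapAddMonoidHom, map_sum, ← Multiset.coe_sumAddMonoidHom, map_sum]
      refine sum_eq_zero fun i _ => ?_
      simp only [Multiset.coe_mapAddMonoidHom, Multiset.coe_sumAddMonoidHom]
      rw [sum_map_weight_iterate w σ hw, hA i (mem_univ i), hUs, mul_zero]
    have h2 : (∏ i ∈ B, ((A i).map vec).prod) * (b.map vec).prod ∈ N := by
      rw [hmon B A, ← Multiset.prod_add, ← Multiset.map_add]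
      apply hN _ (by simp [hb])
      rw [Multiset.card_add, Multiset.card_sum, ← hAd]
      have := sum_lt_sum_of_subset (f := fun i => (A i).card) (subset_univ B) (mem_univ j) hj
        (hA0 j) (fun _ _ _ => Nat.zero_le _)
      omega
    have h3 := N.smul_mem (⟨_, R.mul_mem (R.pow_mem (R.neg_mem R.one_mem) #B) h1⟩ : R) h2
    rw [mul_assoc]
    exact h3
  rw [← add_sum_erase _ _ (mem_powerset.2 (subset_univ (univ : Finset (Fin q))))] at key2
  have h4 := (N.add_mem_iff_left (sum_mem hterm)).1 (key2 ▸ N.zero_mem)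
  rw [sdiff_self] at h4
  simp only [bot_eq_empty, prod_empty, map_one, sum_const, card_range, nsmul_eq_mul, mul_one] at h4
  rw [hmon, mul_assoc, ← Multiset.prod_add, ← Multiset.map_add] at h4
  have hu : ((-1) ^ #(univ : Finset (Fin q)) * (q : F)) ≠ 0 :=
    mul_ne_zero (pow_ne_zero _ (neg_ne_zero.2 one_ne_zero)) hq
  have h5 : ((-1) ^ #(univ : Finset (Fin q)) * (q : F)) •
      ((∑ i, A i + b).map vec).prod ∈ N := by
    rw [Algebra.smul_def]
    simpa using h4
  rw [← inv_smul_smul₀ hu ((∑ i, A i + b).map vec).prod]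
  exact N.smul_of_tower_mem _ h5

/-- The monomials of positive degree lie in each `R`-submodule that contains those of degree at
most `s`, if the degrees above `s` are reducible. -/
theorem prod_map_mem_of_isReducible (hq0 : q ≠ 0) (hq : (q : F) ≠ 0) (hβ : β ^ q = 1)
    (hσ : ∀ x, β (vec x) = vec (σ x)) (hw : ∀ x, w (σ x) = r * w x)
    (hR : ∀ u : Multiset X, (u.map w).sum = 0 → ∑ t ∈ range q, (β ^ t) (u.map vec).prod ∈ R)
    (N : Submodule R L) (s : ℕ) (hs : ∀ d, s < d → IsReducible q r d)
    (hN : ∀ m : Multiset X, m ≠ 0 → m.card ≤ s → (m.map vec).prod ∈ N) (m : Multiset X)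
    (hm : m ≠ 0) : (m.map vec).prod ∈ N := by
  induction hd : m.card using Nat.strong_induction_on generalizing m with
  | _ d ih =>
    by_cases hds : d ≤ s
    · exact hN m hm (hd.trans_le hds)
    · have hN' : ∀ m : Multiset X, m ≠ 0 → m.card < d → (m.map vec).prod ∈ N :=
        fun m hm hmd => ih _ hmd m hm rfl
      exact hs d (by omega) _ (orbitClosed_of_submodule hq0 hσ hw hR N d hN')
        (productClosed_of_submodule hq hβ hσ hw hR N d hN') (m.map w)
        (by rw [Multiset.card_map, hd]) m rfl

end Monomials

/-! ### Generation of the positive-degree ideal and finiteness. -/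

namespace InvariantDegree

open Finset

section

variable {F G W : Type*} [Field F] [Group G] [AddCommGroup W] [Module F W]

theorem act_ι (ρ : Representation F G W) (g : G) (y : Module.Dual F W) :
    act ρ g (SymmetricAlgebra.ι F _ y) =
      SymmetricAlgebra.ι F _ (Module.Dual.transpose (R := F) (ρ g) y) := by
  rw [act, SymmetricAlgebra.lift_ι_apply]
  rfl

theorem transpose_mul_apply (ρ : Representation F G W) (g h : G) (y : Module.Dual F W) :
    Module.Dual.transpose (R := F) (ρ (g * h)) y =
      Module.Dual.transpose (R := F) (ρ h) (Module.Dual.transpose (R := F) (ρ g) y) := by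
  rw [map_mul]
  rfl

theorem transpose_pow (ρ : Representation F G W) (g : G) (k : ℕ) :
    Module.Dual.transpose (R := F) (ρ (g ^ k)) = Module.Dual.transpose (R := F) (ρ g) ^ k := by
  induction k with
  | zero =>
    rw [pow_zero, pow_zero, map_one]
    rfl
  | succ k ih =>
    ext1 y
    rw [pow_succ, pow_succ', transpose_mul_apply, ih]
    rfl

theorem algHom_ext_ι {f g : CoordRing F W →ₐ[F] CoordRing F W}
    (h : ∀ y, f (SymmetricAlgebra.ι F _ y) = g (SymmetricAlgebra.ι F _ y)) : f = g :=
  SymmetricAlgebra.algHom_ext (LinearMap.ext h)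

/-- Substitution is a right action, so the order of the factors is reversed. -/
theorem act_mul (ρ : Representation F G W) (g h : G) : act ρ (g * h) = act ρ h * act ρ g :=
  algHom_ext_ι fun y => by rw [AlgHom.mul_apply, act_ι, act_ι, act_ι, transpose_mul_apply]

theorem act_pow (ρ : Representation F G W) (g : G) (k : ℕ) : act ρ (g ^ k) = act ρ g ^ k := by
  induction k with
  | zero =>
    rw [pow_zero, pow_zero]
    refine algHom_ext_ι fun y => ?_
    rw [act_ι, map_one]
    rfl
  | succ k ih => rw [pow_succ, pow_succ', act_mul, ih]

theorem component_eq_span {X : Type*} (v : X → Module.Dual F W)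
    (hv : Submodule.span F (Set.range v) = ⊤) (d : ℕ) :
    component F W d ≤ Submodule.span F {f | ∃ m : Multiset X, m.card = d ∧
      f = (m.map fun x => SymmetricAlgebra.ι F _ (v x)).prod} := by
  have hι : LinearMap.range (SymmetricAlgebra.ι F (Module.Dual F W)) =
      Submodule.span F (Set.range fun x => SymmetricAlgebra.ι F _ (v x)) := by
    rw [← Submodule.map_top, ← hv, Submodule.map_span, ← Set.range_comp]
    rfl
  rw [component, hι]
  induction d with
  | zero =>
    rw [pow_zero, Submodule.one_eq_span, Submodule.span_le, Set.singleton_subset_iff]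
    exact Submodule.subset_span ⟨0, rfl, by simp⟩
  | succ d ih =>
    rw [pow_succ]
    refine (mul_le_mul' ih le_rfl).trans ?_
    rw [Submodule.span_mul_span, Submodule.span_le]
    rintro _ ⟨_, ⟨m, hm, rfl⟩, _, ⟨x, rfl⟩, rfl⟩
    refine Submodule.subset_span ⟨x ::ₘ m, by rw [Multiset.card_cons, hm], ?_⟩
    rw [Multiset.map_cons, Multiset.prod_cons, mul_comm]

theorem prod_map_ι_mem_component {X : Type*} (v : X → Module.Dual F W) (m : Multiset X) :
    (m.map fun x => SymmetricAlgebra.ι F _ (v x)).prod ∈ component F W m.card := by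
  induction m using Multiset.induction with
  | empty =>
    rw [component, Multiset.card_zero, pow_zero]
    exact Submodule.one_le.1 le_rfl
  | cons x m ih =>
    rw [Multiset.map_cons, Multiset.prod_cons, Multiset.card_cons, component, pow_succ']
    exact Submodule.mul_mem_mul ⟨_, rfl⟩ ih

/-- The hypothesis is applied to the image in `F[W]` of the submodule generated in degrees at most
`s`. -/
theorem span_plusComponent_eq_top {X : Type*} (v : X → Module.Dual F W)
    (hv : Submodule.span F (Set.range v) = ⊤) (R : Subalgebra F (CoordRing F W)) (s : ℕ)
    (h : ∀ N : Submodule R (CoordRing F W), (∀ m : Multiset X, m ≠ 0 → m.card ≤ s →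
      (m.map fun x => SymmetricAlgebra.ι F _ (v x)).prod ∈ N) → ∀ m : Multiset X, m ≠ 0 →
      (m.map fun x => SymmetricAlgebra.ι F _ (v x)).prod ∈ N) :
    Submodule.span R ((⨆ d ∈ Set.Iic s, plusComponent F W d : Submodule F (plusIdeal F W)) :
      Set (plusIdeal F W)) = ⊤ := by
  set P := Submodule.span R ((⨆ d ∈ Set.Iic s, plusComponent F W d :
    Submodule F (plusIdeal F W)) : Set (plusIdeal F W)) with hP
  set N : Submodule R (CoordRing F W) := P.map ((plusIdeal F W).subtype.restrictScalars R) with hN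
  have hmem : ∀ m : Multiset X, m ≠ 0 →
      (m.map fun x => SymmetricAlgebra.ι F _ (v x)).prod ∈ N := by
    refine h N fun m hm hms => ?_
    have hmc := prod_map_ι_mem_component v m
    have h1 : 1 ≤ m.card := Multiset.card_pos.2 hm
    have hmp : (m.map fun x => SymmetricAlgebra.ι F _ (v x)).prod ∈ plusIdeal F W :=
      Ideal.subset_span (Set.mem_biUnion (Set.mem_Ici.2 h1) hmc)
    refine ⟨⟨_, hmp⟩, Submodule.subset_span ?_, rfl⟩
    exact Submodule.mem_iSup_of_mem m.card (Submodule.mem_iSup_of_mem hms hmc)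
  rw [eq_top_iff]
  intro x _
  have hx : (x : CoordRing F W) ∈ (plusIdeal F W).restrictScalars F := x.2
  rw [plusIdeal_restrictScalars] at hx
  have hle : (⨆ d ∈ Set.Ici 1, component F W d) ≤ N.restrictScalars F := by
    refine iSup₂_le fun d hd => (component_eq_span v hv d).trans ?_
    rw [Submodule.span_le]
    rintro _ ⟨m, rfl, rfl⟩
    exact hmem m (Multiset.card_pos.1 hd)
  obtain ⟨y, hy, hyx⟩ := hle hx
  have : y = x := Subtype.ext hyx
  exact this ▸ hy

theorem finite_of_span_plusComponent [FiniteDimensional F W] {R : Subalgebra F (CoordRing F W)}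
    {s : ℕ} (h : Submodule.span R ((⨆ d ∈ Set.Iic s, plusComponent F W d :
      Submodule F (plusIdeal F W)) : Set (plusIdeal F W)) = ⊤) :
    Module.Finite R (plusIdeal F W) := by
  have hc : ∀ d, (component F W d).FG := fun d => by
    refine Submodule.FG.pow ?_ d
    rw [← Submodule.map_top]
    exact (Module.Finite.fg_top).map _
  have hpc : ∀ d, (plusComponent F W d).FG := fun d => by
    have hinj : Function.Injective ((plusIdeal F W).subtype.restrictScalars F) :=
      Subtype.val_injective
    have : Module.Finite F (component F W d) := Module.Finite.iff_fg.2 (hc d)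
    refine Submodule.fg_of_fg_map_injective _ hinj ?_
    rw [plusComponent, Submodule.map_comap_eq]
    have : IsNoetherian F (component F W d) := inferInstance
    exact (isNoetherian_submodule.1 this) _ inf_le_right
  have hsup : (⨆ d ∈ Set.Iic s, plusComponent F W d : Submodule F (plusIdeal F W)).FG := by
    have := Submodule.fg_biSup (Finset.Iic s) (fun d => plusComponent F W d) fun d _ => hpc d
    simpa using this
  obtain ⟨S, hS⟩ := hsup
  refine ⟨⟨S, ?_⟩⟩
  rw [eq_top_iff, ← h, Submodule.span_le, ← hS]
  exact Submodule.span_le_restrictScalars F R (S : Set (plusIdeal F W))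

theorem exists_betaPlus_eq [FiniteDimensional F W] (ρ : Representation F G W) {T : Set ℕ}
    (hT : T.Nonempty) (h : ∀ s ∈ T, Submodule.span (invariants ρ)
      ((⨆ d ∈ Set.Iic s, plusComponent F W d : Submodule F (plusIdeal F W)) :
        Set (plusIdeal F W)) = ⊤) :
    ∃ b : ℕ, betaPlus ρ = (b : ℕ∞) ∧ ∀ s ∈ T, b ≤ s := by
  obtain ⟨s₀, hs₀⟩ := hT
  have hfin := finite_of_span_plusComponent (h s₀ hs₀)
  have hle : ∀ s ∈ T, betaPlus ρ ≤ s := fun s hs => by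
    rw [betaPlus, beta, if_pos hfin]
    exact sInf_le ⟨s, rfl, h s hs⟩
  obtain ⟨b, hb⟩ := ENat.ne_top_iff_exists.1 (ne_top_of_le_ne_top (ENat.natCast_ne_top s₀) (hle s₀ hs₀))
  refine ⟨b, hb.symm, fun s hs => ?_⟩
  have := hle s hs
  rw [← hb] at this
  exact_mod_cast this

end

end InvariantDegree

/-! ### Weight vectors for the semidirect product. -/

namespace InvariantDegree

open Finset Multiplicative

section

variable {p q : ℕ} [Fact p.Prime] [Fact q.Prime]

theorem ofAdd_one_pow_val {n : ℕ} [NeZero n] (x : ZMod n) :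
    (ofAdd (1 : ZMod n)) ^ x.val = ofAdd x := by
  rw [← ofAdd_nsmul, nsmul_one, ZMod.natCast_zmod_val]

theorem mulAut_apply_ofAdd (f : MulAut (Multiplicative (ZMod p))) (x : ZMod p) :
    f (ofAdd x) = ofAdd (toAdd (f (ofAdd 1)) * x) := by
  conv_lhs => rw [← ofAdd_one_pow_val x, map_pow]
  apply toAdd.injective
  rw [toAdd_pow, toAdd_ofAdd, nsmul_eq_mul, ZMod.natCast_zmod_val, mul_comm]

variable (φ : Multiplicative (ZMod q) →* MulAut (Multiplicative (ZMod p)))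

/-- The residue by which the generator of the acting group multiplies. -/
def multiplier : ZMod p := toAdd (φ (ofAdd 1) (ofAdd 1))

theorem apply_pow_ofAdd_one (k : ℕ) :
    (φ (ofAdd 1) ^ k) (ofAdd 1) = ofAdd (multiplier φ ^ k) := by
  induction k with
  | zero => rw [pow_zero, pow_zero]; rfl
  | succ k ih =>
    rw [pow_succ', MulAut.mul_apply, ih, mulAut_apply_ofAdd, pow_succ']
    rfl

theorem ofAdd_one_pow_self (n : ℕ) : (ofAdd (1 : ZMod n)) ^ n = 1 := by
  rw [← ofAdd_nsmul, nsmul_one, ZMod.natCast_self, ofAdd_zero]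

theorem multiplier_pow : multiplier φ ^ q = 1 := by
  have h := apply_pow_ofAdd_one φ q
  rw [← map_pow, ofAdd_one_pow_self, map_one, MulAut.one_apply] at h
  exact (ofAdd.injective h).symm

theorem multiplier_ne_one (h : ∃ a b : Multiplicative (ZMod p) ⋊[φ] Multiplicative (ZMod q),
    a * b ≠ b * a) : multiplier φ ≠ 1 := by
  intro h1
  obtain ⟨a, b, hab⟩ := h
  have hφ1 : φ (ofAdd 1) = 1 := by
    ext1 x
    rw [← ofAdd_toAdd x, mulAut_apply_ofAdd]
    change ofAdd (multiplier φ * _) = _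
    rw [h1, one_mul, MulAut.one_apply]
  have hφ : ∀ g, φ g = 1 := fun g => by
    rw [← ofAdd_toAdd g, ← ofAdd_one_pow_val, map_pow, hφ1, one_pow]
  apply hab
  ext1
  · rw [SemidirectProduct.mul_left, SemidirectProduct.mul_left, hφ, hφ, MulAut.one_apply,
      MulAut.one_apply, mul_comm]
  · rw [SemidirectProduct.mul_right, SemidirectProduct.mul_right, mul_comm]

open SemidirectProduct in
theorem inr_mul_inl :
    (inr (ofAdd 1) * inl (ofAdd 1) : Multiplicative (ZMod p) ⋊[φ] Multiplicative (ZMod q)) =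
      inl (ofAdd 1) ^ (multiplier φ).val * inr (ofAdd 1) := by
  rw [← map_pow, ofAdd_one_pow_val, multiplier, ofAdd_toAdd, inl_aut, mul_assoc, ← map_mul inr,
    inv_mul_cancel, map_one inr, mul_one]

open SemidirectProduct in
theorem eq_inl_pow_mul_inr_pow (g : Multiplicative (ZMod p) ⋊[φ] Multiplicative (ZMod q)) :
    ∃ i j : ℕ, g = inl (ofAdd 1) ^ i * inr (ofAdd 1) ^ j := by
  refine ⟨(toAdd g.left).val, (toAdd g.right).val, ?_⟩
  rw [← map_pow inl, ← map_pow inr, ofAdd_one_pow_val, ofAdd_one_pow_val, ofAdd_toAdd, ofAdd_toAdd,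
    inl_left_mul_inr_right]

end

section

variable {p : ℕ} [Fact p.Prime] {F V : Type*} [Field F] [IsAlgClosed F] [AddCommGroup V]
  [Module F V] [FiniteDimensional F V]

/-- `X ^ n - 1` is separable when `n` is invertible, so `T` is semisimple, hence diagonalisable over
an algebraically closed field. -/
theorem iSup_eigenspace_eq_top_of_pow_eq_one {n : ℕ} (hn : (n : F) ≠ 0) {T : Module.End F V}
    (hT : T ^ n = 1) : ⨆ μ, T.eigenspace μ = ⊤ := by
  have hss : T.IsSemisimple := by
    refine Module.End.isSemisimple_of_squarefree_aeval_eq_zero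
      (p := (Polynomial.X ^ n - 1 : Polynomial F)) ?_ (by simp [hT])
    exact ((Polynomial.X_pow_sub_one_separable_iff).2 hn).squarefree
  rw [← Module.End.iSup_maxGenEigenspace_eq_top T]
  exact iSup_congr fun μ => (hss.isFinitelySemisimple.maxGenEigenspace_eq_eigenspace μ).symm

theorem span_zmodChar_eigenvectors_eq_top (hp : (p : F) ≠ 0) {ζ : F} (hζ : IsPrimitiveRoot ζ p)
    {T : Module.End F V} (hT : T ^ p = 1) :
    Submodule.span F {y | ∃ χ : ZMod p, T y = AddChar.zmodChar p hζ.pow_eq_one χ • y} = ⊤ := by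
  rw [eq_top_iff, ← iSup_eigenspace_eq_top_of_pow_eq_one hp hT]
  refine iSup_le fun μ y hy => ?_
  rw [Module.End.mem_eigenspace_iff] at hy
  rcases eq_or_ne y 0 with rfl | hy0
  · exact zero_mem _
  have hpow : ∀ k : ℕ, (T ^ k) y = μ ^ k • y := fun k => by
    induction k with
    | zero => simp
    | succ k ih => rw [pow_succ, Module.End.mul_apply, hy, map_smul, ih, smul_smul, pow_succ']
  have hμ : μ ^ p = 1 := by
    have h := hpow p
    rw [hT, Module.End.one_apply] at h
    have h2 : (μ ^ p - 1) • y = 0 := by rw [sub_smul, ← h, one_smul, sub_self]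
    exact sub_eq_zero.1 ((smul_eq_zero.1 h2).resolve_right hy0)
  have : NeZero p := ⟨(Fact.out : p.Prime).ne_zero⟩
  obtain ⟨i, -, rfl⟩ := hζ.eq_pow_of_pow_eq_one hμ
  refine Submodule.subset_span ⟨(i : ZMod p), ?_⟩
  rw [AddChar.zmodChar_apply', hy]

end

section

variable {p q : ℕ} [Fact p.Prime] [Fact q.Prime]
  {φ : Multiplicative (ZMod q) →* MulAut (Multiplicative (ZMod p))}
  {F W : Type*} [Field F] [AddCommGroup W] [Module F W]
  (ρ : Representation F (Multiplicative (ZMod p) ⋊[φ] Multiplicative (ZMod q)) W)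

/-- The linear forms on `W` that are eigenvectors of the generator of the normal subgroup,
together with their weights. -/
abbrev WeightVector (e : AddChar (ZMod p) F) : Type _ :=
  {x : ZMod p × Module.Dual F W //
    Module.Dual.transpose (R := F) (ρ (SemidirectProduct.inl (ofAdd 1))) x.2 = e x.1 • x.2}

variable {ρ} {e : AddChar (ZMod p) F}

/-- With `a`, `b` the generators of `Z_p`, `Z_q`, the relation `b a = a ^ r b` makes `b` multiply
weights by `r`. -/
theorem transpose_inr_mem (x : WeightVector ρ e) :
    Module.Dual.transpose (R := F) (ρ (SemidirectProduct.inl (ofAdd 1)))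
      (Module.Dual.transpose (R := F) (ρ (SemidirectProduct.inr (ofAdd 1))) x.1.2) =
      e (multiplier φ * x.1.1) •
        Module.Dual.transpose (R := F) (ρ (SemidirectProduct.inr (ofAdd 1))) x.1.2 := by
  have hpow : ∀ k : ℕ, (Module.Dual.transpose (R := F)
      (ρ (SemidirectProduct.inl (ofAdd 1))) ^ k) x.1.2 = e (k * x.1.1) • x.1.2 := fun k => by
    induction k with
    | zero => simp
    | succ k ih =>
      rw [pow_succ, Module.End.mul_apply, x.2, map_smul, ih, smul_smul, ← AddChar.map_add_eq_mul]
      congr 2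
      push_cast
      ring
  rw [← transpose_mul_apply, inr_mul_inl, transpose_mul_apply, transpose_pow, hpow, map_smul,
    ZMod.natCast_zmod_val]

/-- The action of the generator of the acting group on the weight vectors. -/
noncomputable def WeightVector.shift (x : WeightVector ρ e) : WeightVector ρ e :=
  ⟨(multiplier φ * x.1.1,
    Module.Dual.transpose (R := F) (ρ (SemidirectProduct.inr (ofAdd 1))) x.1.2),
    transpose_inr_mem x⟩

theorem act_inl_prod_map (m : Multiset (WeightVector ρ e)) :
    act ρ (SemidirectProduct.inl (ofAdd 1))
      (m.map fun x => SymmetricAlgebra.ι F _ x.1.2).prod =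
      e (m.map fun x => x.1.1).sum • (m.map fun x => SymmetricAlgebra.ι F _ x.1.2).prod := by
  induction m using Multiset.induction with
  | empty => simp
  | cons x m ih =>
    rw [Multiset.map_cons, Multiset.prod_cons, Multiset.map_cons, Multiset.sum_cons, map_mul, ih,
      act_ι, x.2, map_smul, smul_mul_smul_comm, AddChar.map_add_eq_mul]

theorem act_inr_ι (x : WeightVector ρ e) :
    act ρ (SemidirectProduct.inr (ofAdd 1)) (SymmetricAlgebra.ι F _ x.1.2) =
      SymmetricAlgebra.ι F _ x.shift.1.2 :=
  act_ι _ _ _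

theorem act_inr_pow : act ρ (SemidirectProduct.inr (ofAdd 1)) ^ q = 1 := by
  rw [← act_pow, ← map_pow, ofAdd_one_pow_self, map_one, ← pow_zero 1, act_pow, pow_zero]

/-- The generator of `Z_q` permutes the summands cyclically; that of `Z_p` fixes each, since its
weight is `r ^ t * 0`. -/
theorem orbit_sum_mem_invariants (u : Multiset (WeightVector ρ e))
    (hu : (u.map fun x => x.1.1).sum = 0) :
    ∑ t ∈ range q, (act ρ (SemidirectProduct.inr (ofAdd 1)) ^ t)
      (u.map fun x => SymmetricAlgebra.ι F _ x.1.2).prod ∈ invariants ρ := by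
  set β := act ρ (SemidirectProduct.inr (ofAdd 1)) with hβ
  set f := ∑ t ∈ range q, (β ^ t) (u.map fun x => SymmetricAlgebra.ι F _ x.1.2).prod with hf
  have hβf : β f = f := by
    rw [hf, map_sum]
    simp_rw [← AlgHom.mul_apply, ← pow_succ']
    have h1 := sum_range_succ' (fun t => (β ^ t) (u.map fun x => SymmetricAlgebra.ι F _ x.1.2).prod) q
    rw [sum_range_succ, hβ, act_inr_pow, pow_zero] at h1
    exact (add_right_cancel h1).symm
  have hαf : act ρ (SemidirectProduct.inl (ofAdd 1)) f = f := by
    rw [hf, map_sum]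
    refine sum_congr rfl fun t _ => ?_
    rw [pow_apply_prod_map β (fun x : WeightVector ρ e => SymmetricAlgebra.ι F _ x.1.2)
      WeightVector.shift act_inr_ι, act_inl_prod_map,
      sum_map_weight_iterate (r := multiplier φ) (fun x : WeightVector ρ e => x.1.1)
        WeightVector.shift (fun _ => rfl), hu, mul_zero,
      AddChar.map_zero_eq_one, one_smul]
  have hpow : ∀ (γ : CoordRing F W →ₐ[F] CoordRing F W), γ f = f → ∀ k : ℕ, (γ ^ k) f = f := by
    intro γ hγ k
    induction k with
    | zero => rfl
    | succ k ih => rw [pow_succ, AlgHom.mul_apply, hγ, ih]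
  intro g
  obtain ⟨i, j, rfl⟩ := eq_inl_pow_mul_inr_pow φ g
  rw [act_mul, act_pow, act_pow, AlgHom.mul_apply, hpow _ hαf, hpow _ hβf]

/-- A spanning family stable under the shift is enough; no basis permuted by `Z_q` is needed. -/
theorem span_weightVector_eq_top [IsAlgClosed F] [FiniteDimensional F W] (hp : (p : F) ≠ 0) {ζ : F}
    (hζ : IsPrimitiveRoot ζ p) :
    Submodule.span F (Set.range fun x : WeightVector ρ (AddChar.zmodChar p hζ.pow_eq_one) =>
      x.1.2) = ⊤ := by
  rw [← span_zmodChar_eigenvectors_eq_top hp hζ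
    (T := Module.Dual.transpose (R := F) (ρ (SemidirectProduct.inl (ofAdd 1)))) (by
      rw [← transpose_pow, ← map_pow, ofAdd_one_pow_self, map_one, map_one]
      rfl)]
  congr 1
  ext y
  constructor
  · rintro ⟨x, rfl⟩
    exact ⟨x.1.1, x.2⟩
  · rintro ⟨χ, hχ⟩
    exact ⟨⟨(χ, y), hχ⟩, rfl⟩

theorem span_plusComponent_eq_top_of_isReducible [IsAlgClosed F] [FiniteDimensional F W]
    (ρ : Representation F (Multiplicative (ZMod p) ⋊[φ] Multiplicative (ZMod q)) W)
    (hp : (p : F) ≠ 0) (hq : (q : F) ≠ 0) (s : ℕ)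
    (hs : ∀ d, s < d → IsReducible q (multiplier φ) d) :
    Submodule.span (invariants ρ) ((⨆ d ∈ Set.Iic s, plusComponent F W d :
      Submodule F (plusIdeal F W)) : Set (plusIdeal F W)) = ⊤ := by
  have : NeZero (p : F) := ⟨hp⟩
  obtain ⟨ζ, hζ⟩ := HasEnoughRootsOfUnity.exists_primitiveRoot F p
  exact span_plusComponent_eq_top _ (span_weightVector_eq_top (ρ := ρ) hp hζ) _ _ fun N hN =>
    prod_map_mem_of_isReducible (Fact.out : q.Prime).ne_zero hq act_inr_pow act_inr_ι (fun _ => rfl)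
      orbit_sum_mem_invariants N s hs hN

end

end InvariantDegree

/-! ### The three bounds. -/

open InvariantDegree in
theorem proposition2p13
    (p q : ℕ) (hp : p.Prime) (hq : q.Prime) (hp_odd : Odd p) (hq_odd : Odd q) (hqp : q ∣ p - 1)
    (φ : Multiplicative (ZMod q) →* MulAut (Multiplicative (ZMod p)))
    (hG : ∃ a b : Multiplicative (ZMod p) ⋊[φ] Multiplicative (ZMod q), a * b ≠ b * a)
    {F : Type*} [Field F] [IsAlgClosed F]
    (hF : ¬ ringChar F ∣ Nat.card (Multiplicative (ZMod p) ⋊[φ] Multiplicative (ZMod q)))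
    {W : Type*} [AddCommGroup W] [Module F W] [FiniteDimensional F W]
    (ρ : Representation F (Multiplicative (ZMod p) ⋊[φ] Multiplicative (ZMod q)) W) :
    ∃ b : ℕ, betaPlus ρ = (b : ℕ∞) ∧
      ((p : ℝ) > q * ((q : ℝ) - 2) →
        (b : ℝ) ≤ 3 / 2 * ((p : ℝ) + ((q : ℝ) - 2) * q) - 2) ∧
      ((p : ℝ) < q * ((q : ℝ) - 2) →
        (b : ℝ) ≤ 2 * (p : ℝ) + ((q : ℝ) - 2) * q - 2) ∧
      (∀ c : ℕ, (c : ℝ) * ((c : ℝ) - 1) < 2 * p → 2 * (p : ℝ) < c * ((c : ℝ) + 1) → c ≤ q →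
        (b : ℝ) ≤ 2 * (p : ℝ) + ((q : ℝ) - 2) * ((c : ℝ) - 1) - 2) := by
  have := Fact.mk hp
  have := Fact.mk hq
  have hr := multiplier_pow φ
  have hr1 := multiplier_ne_one φ hG
  have hcard : Nat.card (Multiplicative (ZMod p) ⋊[φ] Multiplicative (ZMod q)) = p * q := by
    rw [SemidirectProduct.card]
    simp
  rw [hcard] at hF
  have hpF : (p : F) ≠ 0 := fun h => hF (((ringChar.spec F p).1 h).mul_right q)
  have hqF : (q : F) ≠ 0 := fun h => hF (((ringChar.spec F q).1 h).mul_left p)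
  have hp2 := hp.two_le
  have hq2 := hq.two_le
  have hqR : ((q - 2 : ℕ) : ℝ) = (q : ℝ) - 2 := by push_cast [hq2]; ring
  obtain ⟨b, hb, hbs⟩ := exists_betaPlus_eq ρ
    -- Every degree beyond which all degrees are reducible bounds the same `b`; the second bound,
    -- available unconditionally, shows that there is one.
    (T := {s | ∀ d, s < d → IsReducible q (multiplier φ) d})
    ⟨2 * p + (q - 2) * q - 2, fun d hd =>
      isReducible_of_le hq hp_odd hq_odd hqp hr hr1 (by omega)⟩
    fun s hs => span_plusComponent_eq_top_of_isReducible ρ hpF hqF s hs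
  refine ⟨b, hb, fun h => ?_, fun _ => ?_, fun c _ hc2 hcq => ?_⟩
  · have h' : q * (q - 2) < p := by
      rw [← hqR] at h
      exact_mod_cast h
    -- By parity the real bound `3 / 2 * (p + (q - 2) q) - 2` is the integer `3 n - 2`, with no
    -- rounding.
    have heven : Even (p + q * (q - 2)) := by
      refine hp_odd.add_odd (hq_odd.mul ?_)
      obtain ⟨k, rfl⟩ := hq_odd
      exact ⟨k - 1, by omega⟩
    obtain ⟨n, hn⟩ := heven
    have h1 : b ≤ 3 * n - 2 := hbs _ fun d hd =>
      isReducible_of_two_mul_le hq hp_odd hq_odd hqp hr hr1 h' (by omega)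
    have h2 : b + 2 ≤ 3 * n := by omega
    have h3 : (b : ℝ) + 2 ≤ 3 * n := by exact_mod_cast h2
    have h4 : (p : ℝ) + q * ((q : ℝ) - 2) = n + n := by
      rw [← hqR]
      exact_mod_cast hn
    linarith
  · have h1 : b ≤ 2 * p + (q - 2) * q - 2 := hbs _ fun d hd =>
      isReducible_of_le hq hp_odd hq_odd hqp hr hr1 (by omega)
    have h2 : b + 2 ≤ 2 * p + (q - 2) * q := by omega
    have h3 : (b : ℝ) + 2 ≤ 2 * p + ((q - 2 : ℕ) : ℝ) * q := by exact_mod_cast h2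
    rw [hqR] at h3
    linarith
  · have hc2' : 2 * p < c * (c + 1) := by exact_mod_cast hc2
    have hc : 1 ≤ c := by
      by_contra! hc
      interval_cases c
      omega
    have h1 : b ≤ 2 * p + (q - 2) * (c - 1) - 2 := hbs _ fun d hd =>
      isReducible_of_lt_mul hq hp_odd hq_odd hqp hr hr1 hcq hc2' (by omega)
    have h2 : b + 2 ≤ 2 * p + (q - 2) * (c - 1) := by omega
    have h3 : (b : ℝ) + 2 ≤ 2 * p + ((q - 2 : ℕ) : ℝ) * ((c - 1 : ℕ) : ℝ) := by exact_mod_cast h2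
    rw [hqR, Nat.cast_sub hc, Nat.cast_one] at h3
    linarith
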